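/- Let $n,q\ge 0$ and $r\ge 1$ be integers, let $Z\in\mathbb R^{n\times q}$ be a fixed matrix, and let $\Psi(v)=\sum_{j=1}^{r} v_jH_j\in\mathbb R^{q\times q}$ for $v\in\mathbb R^r$, where the $H_j$ are symmetric matrices of zeros and ones with disjoint supports, $H_j\neq 0$ for $j<r$ and $H_r=0$ (so each entry of $\Psi(v)$ is identically zero or one of $v_1,\dots,v_{r-1}$). Put $\Sigma(v)=Z\Psi(v)Z^{\mathsf T}+v_rI_n$ and $\mathbb P=\{\psi\in\mathbb R^r:\Psi(\psi)\text{ is positive semidefinite},\ \psi_r>0\}$. For $\psi\in\mathbb P$ let $Y\sim \mathrm N(0,\Sigma(\psi))$ in $\mathbb R^n$, let $$\ell(\psi)=-\tfrac12\{\log\det\Sigma(\psi)+Y^{\mathsf T}\Sigma(\psi)^{-1}Y\}$$ be the log-likelihood up to a constant, $S(\psi)=\nabla\ell(\psi)\in\mathbb R^r$ the score, and $\mathcal I(\psi)=\mathrm{cov}_\psi\{S(\psi)\}\in\mathbb R^{r\times r}$ the Fisher information. If $\mathcal I(\psi)$ is invertible, let $W^S(\psi)=\mathcal I(\psi)^{-1/2}S(\psi)$.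 For $v\in\mathbb R^r$ let $A(v,\psi)=\Sigma(\psi)^{-1/2}\Sigma(v)\Sigma(\psi)^{-1/2}$ and $$a(v,\psi)=\frac{\Vert A(v,\psi)\Vert}{\Vert A(v,\psi)\Vert_F},$$ the ratio of the spectral to the Frobenius norm, with $a(v,\psi)=1$ if $\Vert A(v,\psi)\Vert_F=0$. Let $\phi$ be the standard normal density. Let $\psi\in\mathbb P$ be such that $\mathcal I(\psi)$ is invertible, and let $v\in\mathbb R^r$ with $\Vert v\Vert=1$ be such that $\tilde v=\mathcal I(\psi)^{-1/2}v\neq 0$ and $a(\tilde v,\psi)^2<1/8$. Then, when $Y\sim\mathrm N(0,\Sigma(\psi))$, the random variable $v^{\mathsf T}W^S(\psi)$ has a continuous density $g(\cdot\,;v,\psi)$ with respect to Lebesgue measure, and for every $t\in\mathbb R$ $$\vert g(t;v,\psi)-\phi(t)\vert\le 0.14\left(4+\frac{0.29}{\{1-8a(\tilde v,\psi)^2\}^2}\right)a(\tilde v,\psi).$$ -/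

import Mathlib

open MeasureTheory ProbabilityTheory
open scoped MatrixOrder

noncomputable section

/-- The parameterization of the `q × q` random effect covariance matrix by `k = r - 1` parameters:
each entry is known to be zero (`none`) or equal to one of the parameters (`some j`), the
pattern is symmetric and every parameter occurs. -/
structure CovPattern (q k : ℕ) where
  entry : Fin q → Fin q → Option (Fin k)
  symm : ∀ a b, entry a b = entry b a
  occurs : ∀ j, ∃ a b, entry a b = some j

namespace CovPattern

variable {n q k : ℕ}

/-- `H_j = ∂Ψ/∂ψ_j`, a matrix of zeros and ones; it vanishes for the last index `j = r`. -/
def H (c : CovPattern q k) (j : Fin (k + 1)) : Matrix (Fin q) (Fin q) ℝ :=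
  Matrix.of fun a b => if (c.entry a b).map Fin.castSucc = some j then 1 else 0

/-- `Ψ(v) = ∑ j, v_j H_j`, for any vector `v` of length `r = k + 1`. -/
def Psi (c : CovPattern q k) (v : EuclideanSpace ℝ (Fin (k + 1))) : Matrix (Fin q) (Fin q) ℝ :=
  ∑ j, v j • c.H j

/-- `Σ(v) = Z Ψ(v) Zᵀ + v_r I_n`, for any vector `v` of length `r = k + 1`. -/
def Sigma (c : CovPattern q k) (Z : Matrix (Fin n) (Fin q) ℝ)
    (v : EuclideanSpace ℝ (Fin (k + 1))) : Matrix (Fin n) (Fin n) ℝ :=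
  Z * c.Psi v * Z.transpose + v (Fin.last k) • (1 : Matrix (Fin n) (Fin n) ℝ)

/-- The parameter set: `Ψ(ψ)` positive semidefinite and `ψ_r > 0`. -/
def paramSet (c : CovPattern q k) : Set (EuclideanSpace ℝ (Fin (k + 1))) :=
  {ψ | (c.Psi ψ).PosSemidef ∧ 0 < ψ (Fin.last k)}

/-- The distribution `N(0, Σ(ψ))` of the response vector (known `β = 0`). -/
def modelLaw (c : CovPattern q k) (Z : Matrix (Fin n) (Fin q) ℝ)
    (ψ : EuclideanSpace ℝ (Fin (k + 1))) : Measure (EuclideanSpace ℝ (Fin n)) :=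
  multivariateGaussian 0 (c.Sigma Z ψ)

/-- The log-likelihood (known `β = 0`), up to an additive constant. -/
def logLik (c : CovPattern q k) (Z : Matrix (Fin n) (Fin q) ℝ)
    (y : EuclideanSpace ℝ (Fin n)) (ψ : EuclideanSpace ℝ (Fin (k + 1))) : ℝ :=
  -(1 / 2) * (Real.log (c.Sigma Z ψ).det
    + dotProduct y.ofLp ((c.Sigma Z ψ)⁻¹.mulVec y.ofLp))

/-- The score: the gradient of the log-likelihood in the parameter. -/
def score (c : CovPattern q k) (Z : Matrix (Fin n) (Fin q) ℝ)
    (y : EuclideanSpace ℝ (Fin n)) (ψ : EuclideanSpace ℝ (Fin (k + 1))) :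
    EuclideanSpace ℝ (Fin (k + 1)) :=
  gradient (c.logLik Z y) ψ

/-- The Fisher information: the covariance matrix of the score at `ψ` under `ψ`. -/
def fisherInfo (c : CovPattern q k) (Z : Matrix (Fin n) (Fin q) ℝ)
    (ψ : EuclideanSpace ℝ (Fin (k + 1))) : Matrix (Fin (k + 1)) (Fin (k + 1)) ℝ :=
  Matrix.of fun i j =>
    covariance (fun y => c.score Z y ψ i) (fun y => c.score Z y ψ j) (c.modelLaw Z ψ)

end CovPattern

/-- `M^{-1/2}`, for a symmetric positive definite matrix `M`. -/
def invSqrt {m : ℕ} (M : Matrix (Fin m) (Fin m) ℝ) : Matrix (Fin m) (Fin m) ℝ :=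
  (CFC.sqrt M)⁻¹

/-- The spectral norm: the operator norm for the Euclidean norm. -/
def specNorm {m : ℕ} (M : Matrix (Fin m) (Fin m) ℝ) : ℝ :=
  ‖Matrix.toEuclideanCLM (𝕜 := ℝ) M‖

/-- The Frobenius norm. -/
def frobNorm {m : ℕ} (M : Matrix (Fin m) (Fin m) ℝ) : ℝ :=
  Real.sqrt (∑ i, ∑ j, M i j ^ 2)

namespace CovPattern

variable {n q k : ℕ}

/-- `W^S(ψ) = I(ψ)^{-1/2} S(ψ)`, at the response `y`. -/
def scoreStat (c : CovPattern q k) (Z : Matrix (Fin n) (Fin q) ℝ)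
    (y : EuclideanSpace ℝ (Fin n)) (ψ : EuclideanSpace ℝ (Fin (k + 1))) :
    EuclideanSpace ℝ (Fin (k + 1)) :=
  Matrix.toEuclideanCLM (𝕜 := ℝ) (invSqrt (c.fisherInfo Z ψ)) (c.score Z y ψ)

/-- `ṽ = I(ψ)^{-1/2} v`. -/
def vTilde (c : CovPattern q k) (Z : Matrix (Fin n) (Fin q) ℝ)
    (v ψ : EuclideanSpace ℝ (Fin (k + 1))) : EuclideanSpace ℝ (Fin (k + 1)) :=
  Matrix.toEuclideanCLM (𝕜 := ℝ) (invSqrt (c.fisherInfo Z ψ)) v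

/-- `A(v, ψ) = Σ(ψ)^{-1/2} Σ(v) Σ(ψ)^{-1/2}`. -/
def A (c : CovPattern q k) (Z : Matrix (Fin n) (Fin q) ℝ)
    (v ψ : EuclideanSpace ℝ (Fin (k + 1))) : Matrix (Fin n) (Fin n) ℝ :=
  invSqrt (c.Sigma Z ψ) * c.Sigma Z v * invSqrt (c.Sigma Z ψ)

open Classical in
/-- `a(v, ψ) = ‖A(v, ψ)‖ / ‖A(v, ψ)‖_F`, and `1` if the denominator vanishes. -/
def a (c : CovPattern q k) (Z : Matrix (Fin n) (Fin q) ℝ)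
    (v ψ : EuclideanSpace ℝ (Fin (k + 1))) : ℝ :=
  if frobNorm (c.A Z v ψ) = 0 then 1
  else specNorm (c.A Z v ψ) / frobNorm (c.A Z v ψ)

end CovPattern

/-- `g` is the continuous density of `μ` with respect to Lebesgue measure on the line; there is at
most one such `g`, so its values at points are determined by `μ`. -/
structure IsContinuousDensity (g : ℝ → ℝ) (μ : Measure ℝ) : Prop where
  continuous : Continuous g
  nonneg : ∀ t, 0 ≤ g t
  eq_withDensity : μ = volume.withDensity fun t => ENNReal.ofReal (g t)

end

/-! Write `u` for `ṽ`. Since `I(ψ)^{-1/2}` is symmetric, `vᵀW^S = uᵀS`. Because `Σ` is linear, the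
covariance along the line `ψ + s u` is `Σ(ψ) + s Σ(u)`, and a single congruence diagonalises the
whole line. Differentiating the log-likelihood there gives `uᵀS = ∑ λ_j (U_j² - 1) / 2`, with `λ_j`
the eigenvalues of `A(u, ψ)` and `U_j` independent standard normals (`inner_score`,
`modelLaw_eq_map_pi`). Its variance `∑ λ_j² / 2` equals `uᵀ I(ψ) u = ‖v‖² = 1`, so `∑ λ_j² = 2`
(`frobNorm_A_vTilde_sq`), while `λ_j² ≤ ‖A‖² = 2a²`.

What remains is a quantitative central limit theorem for densities. The logarithm of the
characteristic function differs from `-t²/2` by a Taylor remainder of order `a|t|³`, and its modulus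
is at most `(1 + 2a²t²)^{-1/(4a²)}`. Hence its distance to `exp(-t²/2)` is at most a constant times
`a|t|³` times the sum of the two decay factors (`norm_quadFormCharFun_sub_le`), which is integrable
exactly when `a² < 1/8`. Fourier inversion (`isContinuousDensity_re_charFunDensity`) then yields the
density, and `1/(2π)` times the `L¹` distance of the characteristic functions bounds the uniform
distance of the densities. The two cubic integrals are explicit, and
`inv_two_pi_mul_cube_integrals_le` rounds the result to the stated constants. -/

open Complex in
/-- Taylor bound for the centred cumulant generating function of half a chi-square variable, on the
imaginary axis. -/
lemma norm_neg_half_log_one_sub_mul_I_le (y : ℝ) :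
    ‖-(1 / 2) * log (1 - y * I) - y * I / 2 + (y : ℂ) ^ 2 / 4‖ ≤ |y| ^ 3 / 6 := by
  -- The derivative comparison runs rightwards from `0`; the sign `s` lets it cover negative `y` as
  -- well.
  have key : ∀ s : ℝ, s ^ 2 = 1 → ∀ x ∈ Set.Icc (0 : ℝ) |y|,
      ‖-(1 / 2) * log (1 - (s * x : ℝ) * I) - (s * x : ℝ) * I / 2 + ((s * x : ℝ) : ℂ) ^ 2 / 4‖
        ≤ x ^ 3 / 6 := by
    intro s hs
    have hder : ∀ x : ℝ, HasDerivAt (fun x : ℝ ↦ -(1 / 2) * log (1 - (s * x : ℝ) * I)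
        - (s * x : ℝ) * I / 2 + ((s * x : ℝ) : ℂ) ^ 2 / 4)
        (-(1 / 2) * ((-((s : ℂ) * I)) / (1 - (s * x : ℝ) * I)) - s * I / 2
          + (2 * ((s * x : ℝ) : ℂ) * s) / 4) x := by
      intro x
      have h0 : HasDerivAt (fun x : ℝ ↦ ((s * x : ℝ) : ℂ)) (s : ℂ) x := by
        have := ((hasDerivAt_id x).const_mul s).ofReal_comp
        simpa using this
      have h1 : HasDerivAt (fun x : ℝ ↦ 1 - ((s * x : ℝ) : ℂ) * I) (-((s : ℂ) * I)) x := by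
        simpa using (h0.mul_const I).const_sub 1
      have h2 := h1.clog_real (x := x) (Or.inl (by simp))
      have h3 := ((h2.const_mul (-(1 / 2) : ℂ)).sub ((h0.mul_const I).div_const 2)).add
        ((h0.pow 2).div_const 4)
      exact h3.congr_deriv (by simp)
    have hB : ∀ x : ℝ, HasDerivAt (fun x : ℝ ↦ x ^ 3 / 6) (x ^ 2 / 2) x := by
      intro x
      exact (((hasDerivAt_id x).pow 3).div_const 6).congr_deriv (by simp; ring)
    refine image_norm_le_of_norm_deriv_right_le_deriv_boundary
      (fun x _ ↦ (hder x).continuousAt.continuousWithinAt)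
      (fun x _ ↦ (hder x).hasDerivWithinAt) (by simp) hB ?_
    intro x hx
    have hne : (1 - ((s * x : ℝ) : ℂ) * I) ≠ 0 := by
      intro h
      have := congrArg re h
      simp at this
    have hge : 1 ≤ ‖(1 - ((s * x : ℝ) : ℂ) * I)‖ := by
      have := abs_re_le_norm (1 - ((s * x : ℝ) : ℂ) * I)
      simpa using this
    have hs' : |s| = 1 := by
      rw [← sq_eq_sq₀ (abs_nonneg s) zero_le_one, sq_abs, hs, one_pow]
    -- The orders below `x²` cancel, and the remaining denominator has modulus at least `1`, so the
    -- derivative is at most `x²/2` in norm.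
    have heq : -(1 / 2) * ((-((s : ℂ) * I)) / (1 - (s * x : ℝ) * I)) - s * I / 2
          + (2 * ((s * x : ℝ) : ℂ) * s) / 4
        = -(s * I / 2 * (s * x : ℝ) ^ 2) / (1 - (s * x : ℝ) * I) := by
      push_cast at hne ⊢
      rw [eq_div_iff hne]
      have hinv : (-((s : ℂ) * I)) / (1 - s * x * I) * (1 - s * x * I) = -((s : ℂ) * I) :=
        div_mul_cancel₀ _ hne
      linear_combination (-(1 / 2) : ℂ) * hinv + (s : ℂ) ^ 2 * x / 2 * I_sq
    rw [heq, norm_div, norm_neg, norm_mul, norm_pow, norm_real, norm_div, norm_mul, norm_real,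
      Real.norm_eq_abs, Real.norm_eq_abs, abs_mul, hs']
    simp only [norm_I, one_mul, mul_one, sq_abs]
    rw [div_le_iff₀ (by linarith)]
    have h2 : ‖(2 : ℂ)‖ = 2 := by simp
    rw [h2]
    nlinarith [sq_nonneg x]
  rcases le_total 0 y with hy | hy
  · have := key 1 (by norm_num) |y| ⟨abs_nonneg y, le_rfl⟩
    rw [one_mul, abs_of_nonneg hy] at this
    rwa [abs_of_nonneg hy]
  · have := key (-1) (by norm_num) |y| ⟨abs_nonneg y, le_rfl⟩
    rw [abs_of_nonpos hy] at this
    rw [abs_of_nonpos hy]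
    simpa using this

open Complex in
-- Integrate the derivative of `exp` along the segment from `w` to `u`: convexity of the real
-- exponential bounds its modulus by the chord, whose mean is the average of the endpoints. Keeping
-- both endpoints preserves both decay factors in `t`.
lemma norm_exp_sub_exp_le (u w : ℂ) :
    ‖exp u - exp w‖ ≤ ‖u - w‖ * ((Real.exp u.re + Real.exp w.re) / 2) := by
  have hder : ∀ x : ℝ, HasDerivAt (fun x : ℝ ↦ exp (w + x * (u - w)) - exp w)
      (exp (w + x * (u - w)) * (u - w)) x := by
    intro x
    have h0 : HasDerivAt (fun x : ℝ ↦ w + (x : ℂ) * (u - w)) (u - w) x := by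
      simpa using ((hasDerivAt_id x).ofReal_comp.mul_const (u - w)).const_add w
    exact h0.cexp.sub_const _
  have hB : ∀ x : ℝ, HasDerivAt
      (fun x : ℝ ↦ ‖u - w‖ * ((x - x ^ 2 / 2) * Real.exp w.re + x ^ 2 / 2 * Real.exp u.re))
      (‖u - w‖ * ((1 - x) * Real.exp w.re + x * Real.exp u.re)) x := by
    intro x
    have hsq : HasDerivAt (fun x : ℝ ↦ x ^ 2 / 2) x x := by
      exact (((hasDerivAt_id x).pow 2).div_const 2).congr_deriv (by simp)
    exact ((((hasDerivAt_id x).sub hsq).mul_const _).add (hsq.mul_const _)).const_mul _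
  have := image_norm_le_of_norm_deriv_right_le_deriv_boundary (a := 0) (b := 1)
      (fun x _ ↦ (hder x).continuousAt.continuousWithinAt)
      (fun x _ ↦ (hder x).hasDerivWithinAt) (by simp) hB ?_ (Set.right_mem_Icc.2 zero_le_one)
  · refine le_trans (le_of_eq ?_) (this.trans (le_of_eq ?_))
    · simp
    · ring
  · intro x hx
    rw [norm_mul, mul_comm, norm_exp]
    refine mul_le_mul_of_nonneg_left ?_ (norm_nonneg _)
    have hc := convexOn_exp.2 (Set.mem_univ w.re) (Set.mem_univ u.re) (sub_nonneg.2 hx.2.le) hx.1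
      (by ring)
    simp only [smul_eq_mul] at hc
    refine le_trans (le_of_eq ?_) hc
    congr 1
    simp
    ring

/-- Concavity of `log (1 + ·)`, compared with its chord from `0` to `M`. -/
lemma mul_log_one_add_le {u M : ℝ} (hu : 0 ≤ u) (huM : u ≤ M) (hM : 0 < M) :
    u / M * Real.log (1 + M) ≤ Real.log (1 + u) := by
  have h := strictConcaveOn_log_Ioi.concaveOn.2 (Set.mem_Ioi.2 one_pos)
    (Set.mem_Ioi.2 (by linarith : 0 < 1 + M))
    (sub_nonneg.2 ((div_le_one hM).2 huM)) (by positivity : 0 ≤ u / M) (by ring)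
  simp only [smul_eq_mul, Real.log_one, mul_zero, zero_add] at h
  have harg : 1 + u = (1 - u / M) * 1 + u / M * (1 + M) := by
    field_simp
    ring
  rwa [harg]

/-! ### Characteristic function of a diagonal Gaussian quadratic form -/

open Complex in
/-- The characteristic function of `∑ j, l j * (U j ^ 2 - 1) / 2` for independent standard normal
`U j`. -/
noncomputable def quadFormCharFun {ι : Type*} [Fintype ι] (l : ι → ℝ) (t : ℝ) : ℂ :=
  ∏ j, exp (-(1 / 2) * log (1 - (t * l j : ℝ) * I) - (t * l j : ℝ) * I / 2)

section quadFormCharFun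

variable {ι : Type*} [Fintype ι] {l : ι → ℝ} {a : ℝ}

lemma re_log_one_sub_mul_I (y : ℝ) :
    (Complex.log (1 - y * Complex.I)).re = Real.log (1 + y ^ 2) / 2 := by
  rw [Complex.log_re, Complex.norm_def, Real.log_sqrt (Complex.normSq_nonneg _)]
  simp [Complex.normSq_apply, sq]

open Complex in
-- Each factor has modulus `(1 + t² l_j²)^{-1/4}`. The chord bound with `M = 2a²t²` makes the
-- logarithms proportional to `l_j²`, so they add up through `∑ l_j² = 2`; the worst case is all
-- nonzero `l_j²` equal to `2a²`.
lemma norm_quadFormCharFun_le (ha : 0 < a) (hl : ∑ j, l j ^ 2 = 2)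
    (hla : ∀ j, l j ^ 2 ≤ 2 * a ^ 2) (t : ℝ) :
    ‖quadFormCharFun l t‖ ≤ (1 + 2 * a ^ 2 * t ^ 2) ^ (-(1 / (4 * a ^ 2))) := by
  rw [quadFormCharFun, ← exp_sum, norm_exp, Real.rpow_def_of_pos (by positivity), re_sum]
  refine Real.exp_le_exp.2 ?_
  rcases eq_or_ne t 0 with rfl | ht
  · simp
  have ht2 : 0 < t ^ 2 := by positivity
  have hterm : ∀ j, (-(1 / 2) * log (1 - (t * l j : ℝ) * I) - (t * l j : ℝ) * I / 2).re
      ≤ -(1 / 4) * (l j ^ 2 / (2 * a ^ 2) * Real.log (1 + 2 * a ^ 2 * t ^ 2)) := by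
    intro j
    have h1 : (-(1 / 2) * log (1 - (t * l j : ℝ) * I) - (t * l j : ℝ) * I / 2).re
        = -(1 / 2) * (log (1 - (t * l j : ℝ) * I)).re := by
      simp [div_eq_mul_inv]
    rw [h1, re_log_one_sub_mul_I]
    have h2 := mul_log_one_add_le (u := (t * l j) ^ 2) (M := 2 * a ^ 2 * t ^ 2) (by positivity)
      (by rw [mul_pow]; nlinarith [hla j]) (by positivity)
    have h3 : (t * l j) ^ 2 / (2 * a ^ 2 * t ^ 2) = l j ^ 2 / (2 * a ^ 2) := by
      field_simp
    rw [h3] at h2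
    linarith
  refine (Finset.sum_le_sum fun j _ ↦ hterm j).trans (le_of_eq ?_)
  rw [← Finset.mul_sum, ← Finset.sum_mul, ← Finset.sum_div, hl]
  field_simp

open Complex in
-- The quadratic Taylor terms sum exactly to `-t²/2`. The cubic remainders are summed by `|l_j|³ ≤
-- √2 a l_j²`, giving `√2 a |t|³ / 3`; averaging the two exponentials supplies the other factor
-- `1/2`.
lemma norm_quadFormCharFun_sub_le (ha : 0 < a) (hl : ∑ j, l j ^ 2 = 2)
    (hla : ∀ j, l j ^ 2 ≤ 2 * a ^ 2) (t : ℝ) :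
    ‖quadFormCharFun l t - exp (-(t : ℂ) ^ 2 / 2)‖ ≤
      √2 * a / 6 * (|t| ^ 3 * (1 + 2 * a ^ 2 * t ^ 2) ^ (-(1 / (4 * a ^ 2)))
        + |t| ^ 3 * Real.exp (-t ^ 2 / 2)) := by
  have hn := norm_quadFormCharFun_le ha hl hla t
  rw [quadFormCharFun, ← exp_sum] at hn ⊢
  rw [norm_exp] at hn
  refine (norm_exp_sub_exp_le _ _).trans ?_
  have hre : (-(t : ℂ) ^ 2 / 2).re = -t ^ 2 / 2 := by
    have : (-(t : ℂ) ^ 2 / 2) = ((-t ^ 2 / 2 : ℝ) : ℂ) := by push_cast; ring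
    rw [this, ofReal_re]
  rw [hre]
  have hdist : ‖∑ j, (-(1 / 2) * log (1 - (t * l j : ℝ) * I) - (t * l j : ℝ) * I / 2)
      - (-(t : ℂ) ^ 2 / 2)‖ ≤ √2 * a / 3 * |t| ^ 3 := by
    have hsum : (-(t : ℂ) ^ 2 / 2) = -∑ j, ((t * l j : ℝ) : ℂ) ^ 2 / 4 := by
      have : ∑ j, ((t * l j : ℝ) : ℂ) ^ 2 / 4 = ((t ^ 2 / 4 * ∑ j, l j ^ 2 : ℝ) : ℂ) := by
        rw [Finset.mul_sum]
        push_cast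
        exact Finset.sum_congr rfl fun j _ ↦ by ring
      rw [this, hl]
      push_cast
      ring
    rw [hsum, sub_neg_eq_add, ← Finset.sum_add_distrib]
    refine (norm_sum_le _ _).trans ?_
    have hterm : ∀ j, |t * l j| ^ 3 / 6 ≤ √2 * a / 6 * |t| ^ 3 * l j ^ 2 := by
      intro j
      have h1 : |l j| ≤ √2 * a := by
        refine abs_le_of_sq_le_sq ?_ (by positivity)
        rw [mul_pow, Real.sq_sqrt (by norm_num)]
        exact hla j
      rw [abs_mul, mul_pow, pow_succ |l j|, sq_abs]
      have h2 : 0 ≤ |t| ^ 3 * l j ^ 2 / 6 := by positivity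
      nlinarith
    refine (Finset.sum_le_sum fun j _ ↦
      (norm_neg_half_log_one_sub_mul_I_le (t * l j)).trans (hterm j)).trans (le_of_eq ?_)
    rw [← Finset.mul_sum, hl]
    ring
  calc _ ≤ (√2 * a / 3 * |t| ^ 3) * (((1 + 2 * a ^ 2 * t ^ 2) ^ (-(1 / (4 * a ^ 2)))
        + Real.exp (-t ^ 2 / 2)) / 2) := by
        gcongr
    _ = _ := by ring

end quadFormCharFun

/-! ### The two cubic integrals and the numerical constant -/

lemma integrableOn_and_integral_Ioi_cube_mul_rpow (a : ℝ) (ha : 0 < a) (ha' : a ^ 2 < 1 / 8) :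
    IntegrableOn (fun t : ℝ ↦ t ^ 3 * (1 + 2 * a ^ 2 * t ^ 2) ^ (-(1 / (4 * a ^ 2)))) (Set.Ioi 0) ∧
    ∫ t in Set.Ioi (0 : ℝ), t ^ 3 * (1 + 2 * a ^ 2 * t ^ 2) ^ (-(1 / (4 * a ^ 2)))
      = 2 / ((1 - 4 * a ^ 2) * (1 - 8 * a ^ 2)) := by
  set p : ℝ := 1 / (4 * a ^ 2) with hp
  have ha2 : 0 < a ^ 2 := by positivity
  -- The integrand decays like `t^{3-2p}`, so this is the integrability condition, and it is where
  -- `1/8` originates.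
  have hp2 : 2 < p := by
    rw [hp, lt_div_iff₀ (by positivity)]
    linarith
  -- Antiderivative from `w = 1 + 2a²t²`, for which `t³ dt = (w - 1) dw / (8a⁴)`.
  set F : ℝ → ℝ := fun t ↦ 1 / (8 * a ^ 4) * ((1 + 2 * a ^ 2 * t ^ 2) ^ (2 - p) / (2 - p)
    - (1 + 2 * a ^ 2 * t ^ 2) ^ (1 - p) / (1 - p)) with hF
  have hpos : ∀ t : ℝ, 0 < 1 + 2 * a ^ 2 * t ^ 2 := fun t ↦ by positivity
  have hder : ∀ t : ℝ, HasDerivAt F (t ^ 3 * (1 + 2 * a ^ 2 * t ^ 2) ^ (-p)) t := by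
    intro t
    have h0 : HasDerivAt (fun t : ℝ ↦ 1 + 2 * a ^ 2 * t ^ 2) (4 * a ^ 2 * t) t := by
      exact ((((hasDerivAt_id t).pow 2).const_mul (2 * a ^ 2)).const_add 1).congr_deriv
        (by simp; ring)
    have h1 := h0.rpow_const (p := 2 - p) (Or.inl (hpos t).ne')
    have h2 := h0.rpow_const (p := 1 - p) (Or.inl (hpos t).ne')
    have h3 := ((h1.div_const (2 - p)).sub (h2.div_const (1 - p))).const_mul (1 / (8 * a ^ 4))
    refine h3.congr_deriv ?_
    have e1 : (2 - p - 1) = 1 + -p := by ring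
    have e2 : (1 - p - 1) = -p := by ring
    rw [e1, e2, Real.rpow_add (hpos t), Real.rpow_one]
    have : (2 - p) ≠ 0 := by linarith
    have : (1 - p) ≠ 0 := by linarith
    generalize (1 + 2 * a ^ 2 * t ^ 2) ^ (-p) = w
    field_simp
    ring
  have hlim : Filter.Tendsto F Filter.atTop (nhds 0) := by
    have hbase : Filter.Tendsto (fun t : ℝ ↦ 1 + 2 * a ^ 2 * t ^ 2) Filter.atTop Filter.atTop :=
      Filter.tendsto_atTop_add_const_left _ _
        ((Filter.tendsto_pow_atTop two_ne_zero).const_mul_atTop (by positivity))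
    have g1 : Filter.Tendsto (fun t : ℝ ↦ (1 + 2 * a ^ 2 * t ^ 2) ^ (2 - p)) Filter.atTop
        (nhds 0) := by
      have := (tendsto_rpow_neg_atTop (y := p - 2) (by linarith)).comp hbase
      simpa [Function.comp_def] using this
    have g2 : Filter.Tendsto (fun t : ℝ ↦ (1 + 2 * a ^ 2 * t ^ 2) ^ (1 - p)) Filter.atTop
        (nhds 0) := by
      have := (tendsto_rpow_neg_atTop (y := p - 1) (by linarith)).comp hbase
      simpa [Function.comp_def] using this
    simpa using ((g1.div_const (2 - p)).sub (g2.div_const (1 - p))).const_mul (1 / (8 * a ^ 4))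
  have hnn : ∀ t ∈ Set.Ioi (0 : ℝ), 0 ≤ t ^ 3 * (1 + 2 * a ^ 2 * t ^ 2) ^ (-p) := fun t ht ↦
    mul_nonneg (pow_nonneg (le_of_lt ht) 3) (Real.rpow_nonneg (hpos t).le _)
  refine ⟨integrableOn_Ioi_deriv_of_nonneg' (fun t _ ↦ hder t) hnn hlim, ?_⟩
  rw [integral_Ioi_of_hasDerivAt_of_nonneg' (fun t _ ↦ hder t) hnn hlim]
  simp only [hF, ne_eq, OfNat.ofNat_ne_zero, not_false_eq_true, zero_pow, mul_zero, add_zero,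
    Real.one_rpow]
  have h1 : (2 - p) = -(1 - 8 * a ^ 2) / (4 * a ^ 2) := by rw [hp]; field_simp; ring
  have h2 : (1 - p) = -(1 - 4 * a ^ 2) / (4 * a ^ 2) := by rw [hp]; field_simp; ring
  rw [h1, h2]
  have h8 : (1 - 8 * a ^ 2) ≠ 0 := by linarith
  have h4 : (1 - 4 * a ^ 2) ≠ 0 := by linarith
  generalize h8' : 1 - 8 * a ^ 2 = y at *
  generalize h4' : 1 - 4 * a ^ 2 = z at *
  have ha4 : a ^ 4 = (a ^ 2) ^ 2 := by ring
  have haz : a ^ 2 = (z - y) / 4 := by linarith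
  have hzy : z - y ≠ 0 := by intro h; rw [h] at haz; linarith
  rw [ha4, haz]
  field_simp
  ring

lemma integrableOn_and_integral_Ioi_cube_mul_exp :
    IntegrableOn (fun t : ℝ ↦ t ^ 3 * Real.exp (-t ^ 2 / 2)) (Set.Ioi 0) ∧
    ∫ t in Set.Ioi (0 : ℝ), t ^ 3 * Real.exp (-t ^ 2 / 2) = 2 := by
  set F : ℝ → ℝ := fun t ↦ -(t ^ 2 + 2) * Real.exp (-t ^ 2 / 2) with hF
  have hder : ∀ t : ℝ, HasDerivAt F (t ^ 3 * Real.exp (-t ^ 2 / 2)) t := by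
    intro t
    have h0 : HasDerivAt (fun t : ℝ ↦ t ^ 2) (2 * t) t := by
      simpa using hasDerivAt_pow 2 t
    have h1 := (h0.neg.div_const 2).exp
    refine ((h0.add_const 2).neg.mul h1).congr_deriv ?_
    simp only [Pi.neg_apply]
    ring
  have hlim : Filter.Tendsto F Filter.atTop (nhds 0) := by
    have hbase : Filter.Tendsto (fun t : ℝ ↦ t ^ 2 / 2) Filter.atTop Filter.atTop :=
      (Filter.tendsto_pow_atTop two_ne_zero).atTop_div_const (by norm_num)
    have g1 := (Real.tendsto_pow_mul_exp_neg_atTop_nhds_zero 1).comp hbase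
    have g2 := (Real.tendsto_pow_mul_exp_neg_atTop_nhds_zero 0).comp hbase
    have := (g1.add g2).const_mul (-2)
    simp only [add_zero, mul_zero] at this
    refine this.congr fun t ↦ ?_
    simp [hF, neg_div]
    ring
  have hnn : ∀ t ∈ Set.Ioi (0 : ℝ), 0 ≤ t ^ 3 * Real.exp (-t ^ 2 / 2) := fun t ht ↦
    mul_nonneg (pow_nonneg (le_of_lt ht) 3) (Real.exp_nonneg _)
  refine ⟨integrableOn_Ioi_deriv_of_nonneg' (fun t _ ↦ hder t) hnn hlim, ?_⟩
  rw [integral_Ioi_of_hasDerivAt_of_nonneg' (fun t _ ↦ hder t) hnn hlim]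
  simp [hF]

lemma inv_two_pi_mul_cube_integrals_le {a : ℝ} (ha : 0 < a) (ha' : a ^ 2 < 1 / 8) :
    (2 * Real.pi)⁻¹ * (√2 * a / 6 * (4 / ((1 - 4 * a ^ 2) * (1 - 8 * a ^ 2)) + 4)) ≤
      0.14 * (4 + 0.29 / (1 - 8 * a ^ 2) ^ 2) * a := by
  set y := 1 - 8 * a ^ 2 with hy
  have hy0 : 0 < y := by linarith
  have hy1 : y ≤ 1 := by nlinarith
  have h4 : 1 - 4 * a ^ 2 = (1 + y) / 2 := by rw [hy]; ring
  rw [h4]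
  -- After clearing denominators this is just `y ≤ 1`.
  have h1 : 4 / ((1 + y) / 2 * y) + 4 ≤ 8 / y := by
    rw [div_add' _ _ _ (by positivity), div_le_div_iff₀ (by positivity) hy0]
    nlinarith [mul_nonneg hy0.le hy0.le, mul_nonneg (mul_nonneg hy0.le hy0.le) (sub_nonneg.2 hy1)]
  have h2 : √2 ≤ 1.41422 := by
    rw [Real.sqrt_le_left (by norm_num)]
    norm_num
  have h3 : (2 * Real.pi)⁻¹ ≤ (2 * 3.1415)⁻¹ := by
    gcongr
    exact Real.pi_gt_d4.le
  calc (2 * Real.pi)⁻¹ * (√2 * a / 6 * (4 / ((1 + y) / 2 * y) + 4))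
      ≤ (2 * 3.1415)⁻¹ * (1.41422 * a / 6 * (8 / y)) := by gcongr
    _ = ((2 * 3.1415)⁻¹ * (1.41422 / 6 * 8)) * y * a / y ^ 2 := by field_simp
    _ ≤ 0.14 * (4 * y ^ 2 + 0.29) * a / y ^ 2 := by
        have h5 : ((2 * 3.1415)⁻¹ * (1.41422 / 6 * 8)) * y ≤ 0.14 * (4 * y ^ 2 + 0.29) := by
          norm_num
          -- The difference is about `0.56 y² - 0.3001 y + 0.0406`, with barely negative
          -- discriminant and minimiser near `0.268`; this is what `0.29` is tuned to.
          nlinarith [sq_nonneg (y - 0.268)]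
        exact div_le_div_of_nonneg_right (mul_le_mul_of_nonneg_right h5 ha.le) (by positivity)
    _ = 0.14 * (4 + 0.29 / y ^ 2) * a := by field_simp

/-! ### Fourier inversion for finite measures on the line -/

section FourierInversion

open FourierTransform SchwartzMap Complex

variable {μ : Measure ℝ}

/-- The Fourier transform of the rescaled characteristic function: the only candidate for a
continuous density of `μ`. -/
noncomputable def charFunDensity (μ : Measure ℝ) (x : ℝ) : ℂ :=
  𝓕 (fun t : ℝ ↦ charFun μ (2 * Real.pi * t)) x

lemma integrable_charFun_two_pi_mul (hμ : Integrable (charFun μ)) :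
    Integrable fun t : ℝ ↦ charFun μ (2 * Real.pi * t) :=
  hμ.comp_mul_left' (by positivity)

lemma continuous_charFunDensity (hμ : Integrable (charFun μ)) : Continuous (charFunDensity μ) :=
  VectorFourier.fourierIntegral_continuous Real.continuous_fourierChar
    (L := innerₗ ℝ) (by exact continuous_inner) (integrable_charFun_two_pi_mul hμ)

lemma norm_charFunDensity_sub_le {ν : Measure ℝ} (hμ : Integrable (charFun μ)) (hν : Integrable (charFun ν)) (x : ℝ) :
    ‖charFunDensity μ x - charFunDensity ν x‖ ≤
      (2 * Real.pi)⁻¹ * ∫ t, ‖charFun μ t - charFun ν t‖ := by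
  rw [charFunDensity, charFunDensity, Real.fourier_real_eq, Real.fourier_real_eq, ← integral_sub]
  · refine (norm_integral_le_integral_norm _).trans (le_of_eq ?_)
    simp_rw [← smul_sub, Circle.norm_smul]
    rw [Measure.integral_comp_mul_left (fun t ↦ ‖charFun μ t - charFun ν t‖) (2 * Real.pi),
      abs_of_pos (by positivity), smul_eq_mul]
  · simpa [mul_comm] using
      (Real.fourierIntegral_convergent_iff x).2 (integrable_charFun_two_pi_mul hμ)
  · simpa [mul_comm] using
      (Real.fourierIntegral_convergent_iff x).2 (integrable_charFun_two_pi_mul hν)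

variable [IsFiniteMeasure μ]

/-- Fubini twice: writing `h = 𝓕 (𝓕⁻ h)`, the outer transform moves onto `μ` and produces `charFun
μ`; the transform left on `h` then moves onto `charFun μ`. -/
lemma integral_schwartzMap_eq_integral_charFunDensity (hμ : Integrable (charFun μ)) (h : 𝓢(ℝ, ℂ)) :
    ∫ x, h x ∂μ = ∫ x, h x * charFunDensity μ x := by
  have hL : Continuous fun p : ℝ × ℝ ↦ innerₗ ℝ p.1 p.2 := continuous_inner
  have h1 := VectorFourier.integral_fourierIntegral_smul_eq_flip (L := innerₗ ℝ)
    (μ := volume) (ν := μ) (f := (𝓕⁻ h : 𝓢(ℝ, ℂ))) (g := fun _ ↦ (1 : ℂ))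
    Real.continuous_fourierChar hL (𝓕⁻ h : 𝓢(ℝ, ℂ)).integrable (integrable_const _)
  have h2 := VectorFourier.integral_fourierIntegral_smul_eq_flip (L := innerₗ ℝ)
    (μ := volume) (ν := volume) (f := h) (g := fun t : ℝ ↦ charFun μ (2 * Real.pi * t))
    Real.continuous_fourierChar hL h.integrable (integrable_charFun_two_pi_mul hμ)
  rw [flip_innerₗ] at h1 h2
  have e1 : ∀ x, VectorFourier.fourierIntegral Real.fourierChar volume (innerₗ ℝ)
      (𝓕⁻ h : 𝓢(ℝ, ℂ)) x = h x := by
    intro x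
    have : (𝓕 (𝓕⁻ h : 𝓢(ℝ, ℂ)) : 𝓢(ℝ, ℂ)) x = h x := by
      rw [FourierTransform.fourier_fourierInv_eq]
    rw [← this]
    rfl
  have e2 : ∀ x, VectorFourier.fourierIntegral Real.fourierChar μ (innerₗ ℝ)
      (fun _ ↦ (1 : ℂ)) x = charFun μ (2 * Real.pi * (-x)) := by
    intro x
    rw [charFun_eq_fourierIntegral']
    congr 1
    simp only [smul_eq_mul]
    field_simp
  have e3 : ∀ x, (𝓕⁻ h : 𝓢(ℝ, ℂ)) x = 𝓕 (h : ℝ → ℂ) (-x) := by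
    intro x
    rw [← Real.fourierInv_eq_fourier_neg, SchwartzMap.fourierInv_coe]
  simp only [e1, e2, e3, smul_eq_mul, mul_one] at h1
  -- Both factors carry an argument `-x`, removed together by reflection.
  rw [h1, integral_neg_eq_self (fun x ↦ 𝓕 (h : ℝ → ℂ) x * charFun μ (2 * Real.pi * x)) volume]
  exact h2

/-- A smooth function supported in `[a, b]` and increasing to the indicator of `(a, b)` with `n`. -/
noncomputable def smoothCutoff (a b : ℝ) (n : ℕ) (x : ℝ) : ℝ :=
  Real.smoothTransition (n * (x - a)) * Real.smoothTransition (n * (b - x))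

lemma smoothCutoff_eq_zero {a b x : ℝ} (n : ℕ) (hx : x ∉ Set.Ioo a b) :
    smoothCutoff a b n x = 0 := by
  rw [smoothCutoff]
  rcases le_or_gt x a with h | h
  · rw [Real.smoothTransition.zero_of_nonpos, zero_mul]
    exact mul_nonpos_of_nonneg_of_nonpos (Nat.cast_nonneg n) (by linarith)
  · rw [Real.smoothTransition.zero_of_nonpos (x := n * (b - x)), mul_zero]
    refine mul_nonpos_of_nonneg_of_nonpos (Nat.cast_nonneg n) ?_
    have : b ≤ x := by by_contra! hb; exact hx ⟨h, hb⟩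
    linarith

lemma norm_smoothCutoff_le (a b : ℝ) (n : ℕ) (x : ℝ) :
    ‖(smoothCutoff a b n x : ℂ)‖ ≤ (Set.Ioo a b).indicator 1 x := by
  by_cases hx : x ∈ Set.Ioo a b
  · rw [Set.indicator_of_mem hx, norm_real, smoothCutoff, Real.norm_eq_abs, abs_mul,
      abs_of_nonneg (Real.smoothTransition.nonneg _), abs_of_nonneg (Real.smoothTransition.nonneg _)]
    exact mul_le_one₀ (Real.smoothTransition.le_one _) (Real.smoothTransition.nonneg _)
      (Real.smoothTransition.le_one _)
  · simp [smoothCutoff_eq_zero n hx, hx]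

lemma tendsto_smoothCutoff (a b x : ℝ) :
    Filter.Tendsto (fun n ↦ (smoothCutoff a b n x : ℂ)) Filter.atTop
      (nhds ((Set.Ioo a b).indicator 1 x)) := by
  by_cases hx : x ∈ Set.Ioo a b
  · rw [Set.indicator_of_mem hx]
    have key : ∀ y : ℝ, 0 < y → ∀ᶠ n : ℕ in Filter.atTop, 1 ≤ n * y := fun y hy ↦
      (tendsto_natCast_atTop_atTop.atTop_mul_const hy).eventually_ge_atTop 1
    refine tendsto_const_nhds.congr' ?_
    filter_upwards [key _ (sub_pos.2 hx.1), key _ (sub_pos.2 hx.2)] with n h1 h2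
    simp [smoothCutoff, Real.smoothTransition.one_of_one_le h1,
      Real.smoothTransition.one_of_one_le h2]
  · rw [Set.indicator_of_notMem hx]
    simp [smoothCutoff_eq_zero _ hx]

lemma contDiff_smoothCutoff (a b : ℝ) (n : ℕ) :
    ContDiff ℝ (⊤ : ℕ∞) fun x ↦ (smoothCutoff a b n x : ℂ) := by
  refine ofRealCLM.contDiff.comp ?_
  exact (Real.smoothTransition.contDiff.comp (by fun_prop)).mul
    (Real.smoothTransition.contDiff.comp (by fun_prop))

lemma hasCompactSupport_smoothCutoff (a b : ℝ) (n : ℕ) :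
    HasCompactSupport fun x ↦ (smoothCutoff a b n x : ℂ) :=
  HasCompactSupport.intro (isCompact_Icc (a := a) (b := b)) fun x hx ↦ by
    rw [smoothCutoff_eq_zero n (fun h ↦ hx (Set.Ioo_subset_Icc_self h)), ofReal_zero]

/-- The cutoffs are Schwartz functions converging pointwise to the indicator of the open interval,
endpoints included, so dominated convergence applies on both sides even before `μ` is known to have
no atoms. -/
lemma measureReal_Ioo_eq_integral_charFunDensity (hμ : Integrable (charFun μ)) (a b : ℝ) :
    (μ.real (Set.Ioo a b) : ℂ) = ∫ x in Set.Ioo a b, charFunDensity μ x := by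
  have hG : IntegrableOn (charFunDensity μ) (Set.Ioo a b) :=
    ((continuous_charFunDensity hμ).continuousOn.integrableOn_compact isCompact_Icc).mono_set
      Set.Ioo_subset_Icc_self
  have hn : ∀ n, ∫ x, (smoothCutoff a b n x : ℂ) ∂μ
      = ∫ x, (smoothCutoff a b n x : ℂ) * charFunDensity μ x := fun n ↦
    integral_schwartzMap_eq_integral_charFunDensity hμ
      ((hasCompactSupport_smoothCutoff a b n).toSchwartzMap (contDiff_smoothCutoff a b n))
  have l1 : Filter.Tendsto (fun n ↦ ∫ x, (smoothCutoff a b n x : ℂ) ∂μ) Filter.atTop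
      (nhds (∫ x, (Set.Ioo a b).indicator 1 x ∂μ)) :=
    tendsto_integral_of_dominated_convergence ((Set.Ioo a b).indicator 1)
      (fun n ↦ (contDiff_smoothCutoff a b n).continuous.aestronglyMeasurable)
      ((integrable_const (1 : ℝ)).indicator measurableSet_Ioo)
      (fun n ↦ ae_of_all _ (norm_smoothCutoff_le a b n))
      (ae_of_all _ (tendsto_smoothCutoff a b))
  have l2 : Filter.Tendsto (fun n ↦ ∫ x, (smoothCutoff a b n x : ℂ) * charFunDensity μ x)
      Filter.atTop (nhds (∫ x, (Set.Ioo a b).indicator 1 x * charFunDensity μ x)) := by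
    refine tendsto_integral_of_dominated_convergence
      ((Set.Ioo a b).indicator fun x ↦ ‖charFunDensity μ x‖)
      (fun n ↦ ((contDiff_smoothCutoff a b n).continuous.mul
        (continuous_charFunDensity hμ)).aestronglyMeasurable)
      ((integrable_indicator_iff measurableSet_Ioo).2 hG.norm)
      (fun n ↦ ae_of_all _ fun x ↦ ?_)
      (ae_of_all _ fun x ↦ (tendsto_smoothCutoff a b x).mul_const _)
    rw [norm_mul]
    refine (mul_le_mul_of_nonneg_right (norm_smoothCutoff_le a b n x) (norm_nonneg _)).trans
      (le_of_eq ?_)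
    by_cases hx : x ∈ Set.Ioo a b <;> simp [hx]
  have := tendsto_nhds_unique l1 (l2.congr fun n ↦ (hn n).symm)
  have e1 : ∫ x, (Set.Ioo a b).indicator (1 : ℝ → ℂ) x ∂μ = μ.real (Set.Ioo a b) := by
    rw [integral_indicator measurableSet_Ioo]
    simp
  have e2 : ∀ x, (Set.Ioo a b).indicator (1 : ℝ → ℂ) x * charFunDensity μ x
      = (Set.Ioo a b).indicator (charFunDensity μ) x := by
    intro x
    by_cases hx : x ∈ Set.Ioo a b <;> simp [hx]
  rw [e1] at this
  simp only [e2] at this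
  rw [this, integral_indicator measurableSet_Ioo]

lemma nonneg_of_forall_setIntegral_Ioo_nonneg {g : ℝ → ℝ} (hg : Continuous g)
    (h : ∀ a b, 0 ≤ ∫ x in Set.Ioo a b, g x) (x : ℝ) : 0 ≤ g x := by
  by_contra! hx
  have hev : ∀ᶠ y in nhds x, g y < g x / 2 := hg.continuousAt.eventually_lt_const (by linarith)
  obtain ⟨ε, hε, hball⟩ := Metric.eventually_nhds_iff_ball.1 hev
  rw [Real.ball_eq_Ioo] at hball
  have h1 : ∫ y in Set.Ioo (x - ε) (x + ε), g y ≤ ∫ y in Set.Ioo (x - ε) (x + ε), g x / 2 := by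
    refine setIntegral_mono_on ?_ ?_ measurableSet_Ioo fun y hy ↦ (hball y hy).le
    · exact (hg.continuousOn.integrableOn_compact isCompact_Icc).mono_set Set.Ioo_subset_Icc_self
    · exact integrableOn_const (by simp)
  rw [setIntegral_const, measureReal_def, Real.volume_Ioo, ENNReal.toReal_ofReal (by linarith),
    smul_eq_mul] at h1
  nlinarith [h (x - ε) (x + ε)]

/-- A finite measure on the line with integrable characteristic function has a continuous density,
given by Fourier inversion. -/
lemma isContinuousDensity_re_charFunDensity (hμ : Integrable (charFun μ)) :
    IsContinuousDensity (fun x ↦ (charFunDensity μ x).re) μ := by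
  have hcont := continuous_charFunDensity hμ
  have hre : Continuous fun x ↦ (charFunDensity μ x).re := continuous_re.comp hcont
  have hint : ∀ a b, IntegrableOn (fun x ↦ (charFunDensity μ x).re) (Set.Ioo a b) := fun a b ↦
    (hre.continuousOn.integrableOn_compact isCompact_Icc).mono_set Set.Ioo_subset_Icc_self
  have hIoo : ∀ a b, μ.real (Set.Ioo a b) = ∫ x in Set.Ioo a b, (charFunDensity μ x).re := by
    intro a b
    have h1 := congrArg re (measureReal_Ioo_eq_integral_charFunDensity hμ a b)
    rw [ofReal_re] at h1
    rw [h1]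
    exact (integral_re ((hcont.continuousOn.integrableOn_compact isCompact_Icc).mono_set
      Set.Ioo_subset_Icc_self)).symm
  have hnn : ∀ x, 0 ≤ (charFunDensity μ x).re :=
    nonneg_of_forall_setIntegral_Ioo_nonneg hre fun a b ↦ by
      rw [← hIoo]
      exact measureReal_nonneg
  refine ⟨hre, hnn, ?_⟩
  refine Real.measure_ext_Ioo_rat fun a b ↦ ?_
  rw [withDensity_apply _ measurableSet_Ioo,
    ← ofReal_integral_eq_lintegral_ofReal (hint a b) (ae_of_all _ hnn), ← hIoo,
    ofReal_measureReal]

lemma charFun_gaussianReal_zero_one (t : ℝ) :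
    charFun (gaussianReal 0 1) t = cexp (-(t : ℂ) ^ 2 / 2) := by
  rw [charFun_gaussianReal]
  simp
  ring_nf

lemma integrable_charFun_gaussianReal_zero_one : Integrable (charFun (gaussianReal 0 1)) := by
  have := integrable_cexp_neg_mul_sq (b := 1 / 2) (by simp)
  refine this.congr (ae_of_all _ fun t ↦ ?_)
  simp only [charFun_gaussianReal_zero_one]
  ring_nf

lemma charFunDensity_gaussianReal_zero_one (x : ℝ) :
    charFunDensity (gaussianReal 0 1) x = gaussianPDFReal 0 1 x := by
  have h := congrFun (fourier_gaussian_pi (b := 2 * Real.pi) (by simp [Real.pi_pos])) x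
  have e : (fun t : ℝ ↦ charFun (gaussianReal 0 1) (2 * Real.pi * t))
      = fun t : ℝ ↦ cexp (-Real.pi * (2 * Real.pi) * t ^ 2) := by
    ext t
    rw [charFun_gaussianReal_zero_one]
    congr 1
    push_cast
    ring
  rw [charFunDensity, e, h, gaussianPDFReal]
  have hs : ((2 * Real.pi : ℂ)) ^ (1 / 2 : ℂ) = ((√(2 * Real.pi) : ℝ) : ℂ) := by
    rw [Real.sqrt_eq_rpow, ofReal_cpow (by positivity)]
    push_cast
    rfl
  rw [hs]
  push_cast
  simp only [mul_one]
  rw [one_div]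
  congr 2
  have : (Real.pi : ℂ) ≠ 0 := ofReal_ne_zero.2 Real.pi_ne_zero
  field_simp
  simp

end FourierInversion

/-! ### Gaussian moments and the transform of a squared normal -/

open Complex in
lemma integral_cexp_mul_sq_gaussianReal (y : ℝ) :
    ∫ x, cexp (y * (x : ℂ) ^ 2 / 2 * I) ∂(gaussianReal 0 1)
      = cexp (-(1 / 2) * log (1 - y * I)) := by
  rw [integral_gaussianReal_eq_integral_smul one_ne_zero]
  have hre : 0 < ((1 - y * I) / 2).re := by simp
  have hne : (1 - y * I) ≠ 0 := by
    intro h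
    rw [h] at hre
    simp at hre
  have hpt : ∀ x : ℝ, gaussianPDFReal 0 1 x • cexp (y * (x : ℂ) ^ 2 / 2 * I)
      = ((√(2 * Real.pi))⁻¹ : ℝ) * cexp (-((1 - y * I) / 2) * (x : ℂ) ^ 2) := by
    intro x
    rw [gaussianPDFReal, real_smul]
    push_cast
    rw [mul_assoc, ← exp_add]
    congr 2
    · simp
    · simp
      ring
  simp_rw [hpt]
  rw [integral_const_mul, integral_gaussian_complex hre]
  have hdiv : (Real.pi : ℂ) / ((1 - y * I) / 2) = (2 * Real.pi : ℝ) * (1 - y * I)⁻¹ := by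
    push_cast
    field_simp
  -- Off the negative real axis the principal logarithm satisfies `log z⁻¹ = -log z`, so the square
  -- root in the Gaussian integral lies on the stated branch.
  have harg : (1 - y * I).arg ≠ Real.pi := by
    rw [Ne, arg_eq_pi_iff]
    rintro ⟨h, -⟩
    norm_num at h
  have hpi : (0 : ℝ) < 2 * Real.pi := by positivity
  have hsqrt : √(2 * Real.pi) = Real.exp (Real.log (2 * Real.pi) / 2) := by
    rw [Real.exp_half, Real.exp_log hpi]
  rw [hdiv, cpow_def_of_ne_zero (mul_ne_zero (ofReal_ne_zero.2 hpi.ne') (inv_ne_zero hne)),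
    log_ofReal_mul hpi (inv_ne_zero hne), log_inv _ harg, hsqrt, ← Real.exp_neg, ofReal_exp,
    ← exp_add]
  congr 1
  push_cast
  ring

lemma integrable_pow_gaussianReal (n : ℕ) : Integrable (fun x : ℝ ↦ x ^ n) (gaussianReal 0 1) := by
  have h := (memLp_id_gaussianReal (μ := 0) (v := 1) n).integrable_norm_pow'
  have h2 : Integrable (fun x : ℝ ↦ ‖id x‖ ^ n) (gaussianReal 0 1) := by simpa using h
  refine h2.mono (by fun_prop) (ae_of_all _ fun x ↦ ?_)
  simp

lemma memLp_sq_gaussianReal : MemLp (fun x : ℝ ↦ x ^ 2) 2 (gaussianReal 0 1) := by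
  rw [memLp_two_iff_integrable_sq (by fun_prop)]
  simpa [← pow_mul] using integrable_pow_gaussianReal 4

lemma integral_sq_gaussianReal : ∫ x, x ^ 2 ∂(gaussianReal 0 1) = 1 := by
  have h := variance_eq_sub (memLp_id_gaussianReal (μ := 0) (v := 1) 2)
  simpa using h.symm

lemma integrable_pow_mul_exp_neg_sq_half (n : ℕ) :
    Integrable fun x : ℝ ↦ x ^ n * Real.exp (-x ^ 2 / 2) := by
  have := integrable_rpow_mul_exp_neg_mul_sq (b := 1 / 2) (by norm_num) (s := n)
    (lt_of_lt_of_le (by norm_num) (Nat.cast_nonneg n))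
  refine this.congr (ae_of_all _ fun x ↦ ?_)
  simp only [Real.rpow_natCast]
  congr 2
  ring

lemma integral_pow_four_gaussianReal : ∫ x, x ^ 4 ∂(gaussianReal 0 1) = 3 := by
  -- `(x⁴ - 3) exp(-x²/2)` is an exact derivative, so the fourth moment is three times the total
  -- mass.
  have hder : ∀ x : ℝ, HasDerivAt (fun x ↦ -(x ^ 3 + 3 * x) * Real.exp (-x ^ 2 / 2))
      (x ^ 4 * Real.exp (-x ^ 2 / 2) - 3 * (x ^ 0 * Real.exp (-x ^ 2 / 2))) x := by
    intro x
    have h0 : HasDerivAt (fun t : ℝ ↦ t ^ 2) (2 * x) x := by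
      simpa using hasDerivAt_pow 2 x
    have h1 := (h0.neg.div_const 2).exp
    have h2 : HasDerivAt (fun t : ℝ ↦ -(t ^ 3 + 3 * t)) (-(3 * x ^ 2 + 3)) x := by
      have := ((hasDerivAt_pow 3 x).add ((hasDerivAt_id x).const_mul 3)).neg
      refine this.congr_deriv ?_
      simp
    refine (h2.mul h1).congr_deriv ?_
    simp only [Pi.neg_apply]
    ring
  have hi := integrable_pow_mul_exp_neg_sq_half
  have hF : Integrable fun x : ℝ ↦ -(x ^ 3 + 3 * x) * Real.exp (-x ^ 2 / 2) := by
    refine (((hi 3).add ((hi 1).const_mul 3)).neg).congr (ae_of_all _ fun x ↦ ?_)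
    simp
    ring
  have h := integral_eq_zero_of_hasDerivAt_of_integrable hder ((hi 4).sub ((hi 0).const_mul 3)) hF
  rw [integral_sub (hi 4) ((hi 0).const_mul 3), integral_const_mul, sub_eq_zero] at h
  have key : ∀ n : ℕ, ∫ x, x ^ n ∂(gaussianReal 0 1)
      = (√(2 * Real.pi))⁻¹ * ∫ x : ℝ, x ^ n * Real.exp (-x ^ 2 / 2) := by
    intro n
    rw [integral_gaussianReal_eq_integral_smul one_ne_zero, ← integral_const_mul]
    refine integral_congr_ae (ae_of_all _ fun x ↦ ?_)
    simp [gaussianPDFReal]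
    ring
  have h0 := key 0
  simp only [pow_zero, integral_const, probReal_univ, smul_eq_mul, mul_one] at h0
  rw [key, h]
  simp only [pow_zero]
  linear_combination (-3) * h0

lemma variance_sq_gaussianReal : Var[fun x : ℝ ↦ x ^ 2; gaussianReal 0 1] = 2 := by
  rw [variance_eq_sub memLp_sq_gaussianReal, integral_sq_gaussianReal]
  have : ∀ x : ℝ, ((fun x : ℝ ↦ x ^ 2) ^ 2) x = x ^ 4 := fun x ↦ by simp [← pow_mul]
  simp only [this, integral_pow_four_gaussianReal]
  norm_num

lemma integrable_comp_abs_of_integrableOn_Ioi {f : ℝ → ℝ} (hf : IntegrableOn f (Set.Ioi 0)) :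
    Integrable fun x ↦ f |x| := by
  have h1 : IntegrableOn (fun x ↦ f |x|) (Set.Ioi 0) :=
    hf.congr_fun (fun x hx ↦ by rw [abs_of_pos hx]) measurableSet_Ioi
  have h2 : IntegrableOn (fun x ↦ f |x|) (Set.Iic 0) := by
    rw [integrableOn_Iic_iff_integrableOn_Iio]
    have h3 := (IntegrableOn.comp_neg_Iio (c := 0) (f := fun x ↦ f |x|) (by simpa using h1))
    simpa using h3
  rw [← integrableOn_univ, ← Set.Iic_union_Ioi (a := (0 : ℝ))]
  exact h2.union h1

/-! ### Density of a normalised diagonal quadratic form -/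

section quadForm

variable {ι : Type*} [Fintype ι] (l : ι → ℝ)

lemma memLp_half_mul_sq_sub_one (c : ℝ) :
    MemLp (fun x : ℝ ↦ c / 2 * (x ^ 2 - 1)) 2 (gaussianReal 0 1) :=
  (memLp_sq_gaussianReal.sub (memLp_const 1)).const_mul _

lemma memLp_quadForm_pi :
    MemLp (fun x : ι → ℝ ↦ ∑ j, l j / 2 * (x j ^ 2 - 1)) 2
      (Measure.pi fun _ ↦ gaussianReal 0 1) :=
  memLp_finsetSum _ fun j _ ↦ (memLp_half_mul_sq_sub_one (l j)).comp_measurePreserving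
    (measurePreserving_eval _ j)

lemma variance_quadForm_pi :
    Var[fun x : ι → ℝ ↦ ∑ j, l j / 2 * (x j ^ 2 - 1); Measure.pi fun _ ↦ gaussianReal 0 1]
      = (∑ j, l j ^ 2) / 2 := by
  have h := variance_sum_pi (μ := fun _ : ι ↦ gaussianReal 0 1)
    (X := fun j x ↦ l j / 2 * (x ^ 2 - 1)) fun j ↦ memLp_half_mul_sq_sub_one (l j)
  have e : (fun x : ι → ℝ ↦ ∑ j, l j / 2 * (x j ^ 2 - 1))
      = ∑ j, fun x : ι → ℝ ↦ l j / 2 * (x j ^ 2 - 1) := by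
    ext x
    simp
  rw [e, h, Finset.sum_div]
  refine Finset.sum_congr rfl fun j _ ↦ ?_
  rw [variance_const_mul, variance_sub_const (by fun_prop), variance_sq_gaussianReal]
  ring

open Complex in
lemma charFun_map_quadForm_pi (t : ℝ) :
    charFun ((Measure.pi fun _ : ι ↦ gaussianReal 0 1).map
      fun x ↦ ∑ j, l j / 2 * (x j ^ 2 - 1)) t = quadFormCharFun l t := by
  rw [charFun_apply_real, integral_map (Measurable.aemeasurable (by fun_prop)) (by fun_prop),
    quadFormCharFun]
  have hpt : ∀ x : ι → ℝ, cexp (t * ((∑ j, l j / 2 * (x j ^ 2 - 1) : ℝ) : ℂ) * I)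
      = ∏ j, cexp (((t * l j : ℝ) : ℂ) * (x j : ℂ) ^ 2 / 2 * I)
        * cexp (-((t * l j : ℝ) * I / 2)) := by
    intro x
    simp_rw [← exp_add]
    rw [← exp_sum]
    congr 1
    push_cast
    rw [Finset.mul_sum, Finset.sum_mul]
    exact Finset.sum_congr rfl fun j _ ↦ by ring
  simp_rw [hpt]
  rw [integral_fintype_prod_eq_prod (f := fun j (x : ℝ) ↦
    cexp (((t * l j : ℝ) : ℂ) * (x : ℂ) ^ 2 / 2 * I) * cexp (-((t * l j : ℝ) * I / 2)))]
  refine Finset.prod_congr rfl fun j _ ↦ ?_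
  rw [integral_mul_const, integral_cexp_mul_sq_gaussianReal, ← exp_add, ← sub_eq_add_neg]

variable {l} {a : ℝ}

lemma exists_isContinuousDensity_quadForm (ha : 0 < a) (ha' : a ^ 2 < 1 / 8)
    (hl : ∑ j, l j ^ 2 = 2) (hla : ∀ j, l j ^ 2 ≤ 2 * a ^ 2) :
    ∃ g : ℝ → ℝ, IsContinuousDensity g ((Measure.pi fun _ : ι ↦ gaussianReal 0 1).map
        fun x ↦ ∑ j, l j / 2 * (x j ^ 2 - 1)) ∧
      ∀ t : ℝ, |g t - gaussianPDFReal 0 1 t| ≤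
        0.14 * (4 + 0.29 / (1 - 8 * a ^ 2) ^ 2) * a := by
  set μ : Measure ℝ := (Measure.pi fun _ : ι ↦ gaussianReal 0 1).map
    fun x ↦ ∑ j, l j / 2 * (x j ^ 2 - 1) with hμ
  have hprob : IsProbabilityMeasure μ :=
    Measure.isProbabilityMeasure_map (Measurable.aemeasurable (by fun_prop))
  have hγ := integrable_charFun_gaussianReal_zero_one
  obtain ⟨i1, v1⟩ := integrableOn_and_integral_Ioi_cube_mul_rpow a ha ha'
  obtain ⟨i2, v2⟩ := integrableOn_and_integral_Ioi_cube_mul_exp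
  have j1 : Integrable fun t : ℝ ↦
      |t| ^ 3 * (1 + 2 * a ^ 2 * t ^ 2) ^ (-(1 / (4 * a ^ 2))) := by
    simpa using integrable_comp_abs_of_integrableOn_Ioi i1
  have j2 : Integrable fun t : ℝ ↦ |t| ^ 3 * Real.exp (-t ^ 2 / 2) := by
    simpa using integrable_comp_abs_of_integrableOn_Ioi i2
  have w1 : ∫ t : ℝ, |t| ^ 3 * (1 + 2 * a ^ 2 * t ^ 2) ^ (-(1 / (4 * a ^ 2)))
      = 4 / ((1 - 4 * a ^ 2) * (1 - 8 * a ^ 2)) := by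
    have h := integral_comp_abs
      (f := fun t : ℝ ↦ t ^ 3 * (1 + 2 * a ^ 2 * t ^ 2) ^ (-(1 / (4 * a ^ 2))))
    simp only [sq_abs] at h
    rw [h, v1]
    ring
  have w2 : ∫ t : ℝ, |t| ^ 3 * Real.exp (-t ^ 2 / 2) = 4 := by
    have h := integral_comp_abs (f := fun t : ℝ ↦ t ^ 3 * Real.exp (-t ^ 2 / 2))
    simp only [sq_abs] at h
    rw [h, v2]
    norm_num
  have hbound : ∀ t : ℝ, ‖charFun μ t - charFun (gaussianReal 0 1) t‖ ≤
      √2 * a / 6 * (|t| ^ 3 * (1 + 2 * a ^ 2 * t ^ 2) ^ (-(1 / (4 * a ^ 2)))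
        + |t| ^ 3 * Real.exp (-t ^ 2 / 2)) := by
    intro t
    rw [hμ, charFun_map_quadForm_pi, charFun_gaussianReal_zero_one]
    exact norm_quadFormCharFun_sub_le ha hl hla t
  have hbi : Integrable fun t : ℝ ↦ √2 * a / 6 *
      (|t| ^ 3 * (1 + 2 * a ^ 2 * t ^ 2) ^ (-(1 / (4 * a ^ 2)))
        + |t| ^ 3 * Real.exp (-t ^ 2 / 2)) := (j1.add j2).const_mul _
  -- Integrability of `charFun μ` is deduced from that of the difference, so one bound gives both
  -- existence of the density and the error.
  have hdiff : Integrable fun t : ℝ ↦ charFun μ t - charFun (gaussianReal 0 1) t :=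
    hbi.mono' (by fun_prop) (ae_of_all _ hbound)
  have hint : Integrable (charFun μ) := by
    refine (hdiff.add hγ).congr (ae_of_all _ fun t ↦ ?_)
    simp
  refine ⟨_, isContinuousDensity_re_charFunDensity hint, fun t ↦ ?_⟩
  have hre : (charFunDensity μ t).re - gaussianPDFReal 0 1 t
      = (charFunDensity μ t - charFunDensity (gaussianReal 0 1) t).re := by
    rw [charFunDensity_gaussianReal_zero_one, Complex.sub_re, Complex.ofReal_re]
  rw [hre]
  refine ((Complex.abs_re_le_norm _).trans (norm_charFunDensity_sub_le hint hγ t)).trans ?_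
  refine le_trans ?_ (inv_two_pi_mul_cube_integrals_le ha ha')
  refine mul_le_mul_of_nonneg_left ?_ (by positivity)
  refine (integral_mono hdiff.norm hbi hbound).trans (le_of_eq ?_)
  rw [integral_const_mul, integral_add j1 j2, w1, w2]

end quadForm

/-! ### Matrix calculus, norms and square roots -/

section MatrixPreliminaries

open Matrix

section MatrixCalculus

variable {E : Type*} [NormedAddCommGroup E] [NormedSpace ℝ E] {ι : Type*} [Fintype ι]
  [DecidableEq ι] {M : E → Matrix ι ι ℝ} {x : E}

lemma DifferentiableAt.matrix_det (hM : ∀ i j, DifferentiableAt ℝ (fun v ↦ M v i j) x) :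
    DifferentiableAt ℝ (fun v ↦ (M v).det) x := by
  simp_rw [Matrix.det_apply, Units.smul_def]
  fun_prop

/-- Cramer's rule: the inverse is the adjugate over the determinant, and adjugate entries are
determinants of matrices with one row made constant. -/
lemma DifferentiableAt.dotProduct_inv_mulVec (hM : ∀ i j, DifferentiableAt ℝ (fun v ↦ M v i j) x)
    (hx : (M x).det ≠ 0) (y : ι → ℝ) :
    DifferentiableAt ℝ (fun v ↦ y ⬝ᵥ (M v)⁻¹ *ᵥ y) x := by
  have hadj : ∀ i j, DifferentiableAt ℝ (fun v ↦ (M v).adjugate i j) x := by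
    intro i j
    simp_rw [Matrix.adjugate_apply]
    refine DifferentiableAt.matrix_det fun k l ↦ ?_
    by_cases hk : k = j
    · subst hk
      simp
    · simpa [Matrix.updateRow_ne hk] using hM k l
  have hdet := DifferentiableAt.matrix_det hM
  simp_rw [Matrix.inv_def, Ring.inverse_eq_inv', Matrix.smul_mulVec, dotProduct_smul,
    dotProduct, mulVec, dotProduct, smul_eq_mul]
  exact (hdet.inv hx).mul (by fun_prop)

variable (V : Matrix ι ι ℝ) (l : ι → ℝ)

lemma mul_transpose_add_smul_eq (s : ℝ) :
    V * Vᵀ + s • (V * diagonal l * Vᵀ) = V * diagonal (fun j ↦ 1 + s * l j) * Vᵀ := by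
  have : diagonal (fun j ↦ 1 + s * l j) = (1 : Matrix ι ι ℝ) + s • diagonal l := by
    rw [← diagonal_one, ← diagonal_smul, diagonal_add]
    rfl
  rw [this, Matrix.mul_add, Matrix.add_mul, Matrix.mul_one, Matrix.mul_smul, Matrix.smul_mul]

/-- The derivative of the Gaussian log-likelihood along a line of simultaneously diagonalized
covariance matrices. -/
lemma hasDerivAt_logLik_diagonalized (hV : IsUnit V.det) (y : ι → ℝ) :
    HasDerivAt (fun s : ℝ ↦ -(1 / 2) * (Real.log (V * Vᵀ + s • (V * diagonal l * Vᵀ)).det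
        + y ⬝ᵥ (V * Vᵀ + s • (V * diagonal l * Vᵀ))⁻¹ *ᵥ y))
      (∑ j, l j / 2 * ((V⁻¹ *ᵥ y) j ^ 2 - 1)) 0 := by
  set w := V⁻¹ *ᵥ y with hw
  -- Near `s = 0` all factors are nonzero, so the logarithm splits and the diagonal inverts
  -- entrywise.
  have hpos : ∀ᶠ s : ℝ in nhds 0, ∀ j, 0 < 1 + s * l j := by
    rw [Filter.eventually_all]
    intro j
    have hc : ContinuousAt (fun s : ℝ ↦ 1 + s * l j) 0 := by fun_prop
    exact hc.eventually_const_lt (by simp)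
  have hev : (fun s : ℝ ↦ -(1 / 2) * (Real.log (V * Vᵀ + s • (V * diagonal l * Vᵀ)).det
        + y ⬝ᵥ (V * Vᵀ + s • (V * diagonal l * Vᵀ))⁻¹ *ᵥ y)) =ᶠ[nhds 0]
      fun s : ℝ ↦ -(1 / 2) * (Real.log (V.det ^ 2) + ∑ j, Real.log (1 + s * l j)
        + ∑ j, w j ^ 2 * (1 + s * l j)⁻¹) := by
    filter_upwards [hpos] with s hs
    rw [mul_transpose_add_smul_eq]
    have hdet : (V * diagonal (fun j ↦ 1 + s * l j) * Vᵀ).det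
        = V.det ^ 2 * ∏ j, (1 + s * l j) := by
      rw [det_mul, det_mul, det_transpose, det_diagonal]
      ring
    have hinv : (V * diagonal (fun j ↦ 1 + s * l j) * Vᵀ)⁻¹
        = (V⁻¹)ᵀ * diagonal (fun j ↦ (1 + s * l j)⁻¹) * V⁻¹ := by
      rw [Matrix.mul_inv_rev, Matrix.mul_inv_rev, ← Matrix.mul_assoc, transpose_nonsing_inv]
      congr 2
      refine inv_eq_left_inv ?_
      rw [diagonal_mul_diagonal, ← diagonal_one]
      congr 1
      ext j
      exact inv_mul_cancel₀ (hs j).ne'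
    have hquad : y ⬝ᵥ ((V⁻¹)ᵀ * diagonal (fun j ↦ (1 + s * l j)⁻¹) * V⁻¹) *ᵥ y
        = ∑ j, w j ^ 2 * (1 + s * l j)⁻¹ := by
      rw [← mulVec_mulVec, ← hw, ← mulVec_mulVec, dotProduct_mulVec, vecMul_transpose, ← hw]
      simp only [dotProduct, mulVec_diagonal]
      exact Finset.sum_congr rfl fun j _ ↦ by ring
    rw [hdet, hinv, hquad, Real.log_mul (pow_ne_zero 2 hV.ne_zero)
      (Finset.prod_ne_zero_iff.2 fun j _ ↦ (hs j).ne'), Real.log_prod fun j _ ↦ (hs j).ne']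
  refine HasDerivAt.congr_of_eventuallyEq ?_ hev
  have h0 : ∀ j, HasDerivAt (fun s : ℝ ↦ 1 + s * l j) (l j) 0 := fun j ↦ by
    simpa using ((hasDerivAt_id (0 : ℝ)).mul_const (l j)).const_add 1
  have h1 : HasDerivAt (fun s : ℝ ↦ ∑ j, Real.log (1 + s * l j)) (∑ j, l j) 0 := by
    refine HasDerivAt.fun_sum fun j _ ↦ ?_
    simpa using (h0 j).log (by simp)
  have h2 : HasDerivAt (fun s : ℝ ↦ ∑ j, w j ^ 2 * (1 + s * l j)⁻¹) (∑ j, w j ^ 2 * (-l j)) 0 := by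
    refine HasDerivAt.fun_sum fun j _ ↦ ?_
    simpa using ((h0 j).fun_inv (by simp)).const_mul (w j ^ 2)
  refine (((h1.const_add (Real.log (V.det ^ 2))).add h2).const_mul (-(1 / 2))).congr_deriv ?_
  rw [← Finset.sum_add_distrib, Finset.mul_sum]
  exact Finset.sum_congr rfl fun j _ ↦ by ring

end MatrixCalculus

section Norms

variable {m : ℕ} {B : Matrix (Fin m) (Fin m) ℝ}

lemma abs_eigenvalues_le_specNorm (hB : B.IsHermitian) (j : Fin m) :
    |hB.eigenvalues j| ≤ specNorm B := by
  have h := (Matrix.toEuclideanCLM (𝕜 := ℝ) B).le_opNorm (hB.eigenvectorBasis j)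
  have e : Matrix.toEuclideanCLM (𝕜 := ℝ) B (hB.eigenvectorBasis j)
      = hB.eigenvalues j • hB.eigenvectorBasis j := by
    apply WithLp.ofLp_injective
    rw [Matrix.ofLp_toEuclideanCLM, hB.mulVec_eigenvectorBasis]
    rfl
  rw [e, norm_smul, hB.eigenvectorBasis.orthonormal.1 j, mul_one, mul_one] at h
  exact h

lemma eq_eigenvectorUnitary_mul_diagonal_mul (hB : B.IsHermitian) :
    B = (hB.eigenvectorUnitary : Matrix (Fin m) (Fin m) ℝ) * diagonal hB.eigenvalues
      * (hB.eigenvectorUnitary : Matrix (Fin m) (Fin m) ℝ)ᵀ := by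
  conv_lhs => rw [hB.spectral_theorem]
  rw [Unitary.conjStarAlgAut_apply]
  rfl

lemma eigenvectorUnitary_mul_transpose (hB : B.IsHermitian) :
    (hB.eigenvectorUnitary : Matrix (Fin m) (Fin m) ℝ)
      * (hB.eigenvectorUnitary : Matrix (Fin m) (Fin m) ℝ)ᵀ = 1 :=
  Matrix.mem_unitaryGroup_iff.1 hB.eigenvectorUnitary.2

lemma frobNorm_sq_eq_sum_eigenvalues_sq (hB : B.IsHermitian) :
    frobNorm B ^ 2 = ∑ j, hB.eigenvalues j ^ 2 := by
  rw [frobNorm, Real.sq_sqrt (by positivity)]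
  have h1 : ∑ i, ∑ j, B i j ^ 2 = (B * B).trace := by
    simp only [Matrix.trace, Matrix.diag, Matrix.mul_apply]
    refine Finset.sum_congr rfl fun i _ ↦ Finset.sum_congr rfl fun j _ ↦ ?_
    have : B j i = B i j := by simpa using hB.apply i j
    rw [this, sq]
  set U := (hB.eigenvectorUnitary : Matrix (Fin m) (Fin m) ℝ) with hU
  have hUU : Uᵀ * U = 1 := mul_eq_one_comm.1 (eigenvectorUnitary_mul_transpose hB)
  have h2 : B * B = U * (diagonal hB.eigenvalues * diagonal hB.eigenvalues * Uᵀ) := by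
    conv_lhs => rw [eq_eigenvectorUnitary_mul_diagonal_mul hB, ← hU]
    calc U * diagonal hB.eigenvalues * Uᵀ * (U * diagonal hB.eigenvalues * Uᵀ)
        = U * diagonal hB.eigenvalues * (Uᵀ * U) * diagonal hB.eigenvalues * Uᵀ := by
          simp only [Matrix.mul_assoc]
      _ = _ := by rw [hUU]; simp only [Matrix.mul_assoc, Matrix.mul_one]
  rw [h1, h2, Matrix.trace_mul_comm, Matrix.mul_assoc, hUU, Matrix.mul_one,
    diagonal_mul_diagonal, Matrix.trace_diagonal]
  simp [sq]

end Norms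

section InvSqrt

variable {m : ℕ} {S : Matrix (Fin m) (Fin m) ℝ}

lemma transpose_sqrt (S : Matrix (Fin m) (Fin m) ℝ) : (CFC.sqrt S)ᵀ = CFC.sqrt S :=
  (CFC.sqrt_nonneg S).isSelfAdjoint

lemma isUnit_det_sqrt (hS : S.PosSemidef) (hu : IsUnit S) : IsUnit (CFC.sqrt S).det := by
  rw [isUnit_iff_isUnit_det, ← CFC.sqrt_mul_sqrt_self S hS.nonneg, det_mul] at hu
  exact isUnit_of_mul_isUnit_left hu

lemma transpose_invSqrt (S : Matrix (Fin m) (Fin m) ℝ) : (invSqrt S)ᵀ = invSqrt S := by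
  rw [invSqrt, transpose_nonsing_inv, transpose_sqrt]

lemma invSqrt_mul_mul_invSqrt (hS : S.PosSemidef) (hu : IsUnit S) :
    invSqrt S * S * invSqrt S = 1 := by
  have h := isUnit_det_sqrt hS hu
  calc invSqrt S * S * invSqrt S
      = invSqrt S * (CFC.sqrt S * CFC.sqrt S) * invSqrt S := by
        rw [CFC.sqrt_mul_sqrt_self S hS.nonneg]
    _ = (CFC.sqrt S)⁻¹ * CFC.sqrt S * (CFC.sqrt S * (CFC.sqrt S)⁻¹) := by
        simp only [invSqrt, Matrix.mul_assoc]
    _ = 1 := by rw [nonsing_inv_mul _ h, mul_nonsing_inv _ h, Matrix.mul_one]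

end InvSqrt

end MatrixPreliminaries

/-! ### The score as a quadratic form, and the Fisher information -/

namespace CovPattern

section Score

open Matrix

variable {n q k : ℕ} (c : CovPattern q k) (Z : Matrix (Fin n) (Fin q) ℝ)
  (u : EuclideanSpace ℝ (Fin (k + 1))) {ψ : EuclideanSpace ℝ (Fin (k + 1))}

lemma Psi_add_smul (ψ : EuclideanSpace ℝ (Fin (k + 1))) (s : ℝ) :
    c.Psi (ψ + s • u) = c.Psi ψ + s • c.Psi u := by
  simp only [Psi, PiLp.add_apply, PiLp.smul_apply, smul_eq_mul, add_smul, mul_smul,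
    Finset.sum_add_distrib, Finset.smul_sum]

lemma Sigma_add_smul (ψ : EuclideanSpace ℝ (Fin (k + 1))) (s : ℝ) :
    c.Sigma Z (ψ + s • u) = c.Sigma Z ψ + s • c.Sigma Z u := by
  simp only [Sigma, Psi_add_smul, PiLp.add_apply, PiLp.smul_apply, smul_eq_mul, Matrix.mul_add,
    Matrix.add_mul, Matrix.mul_smul, Matrix.smul_mul, add_smul, smul_add, mul_smul]
  abel

lemma transpose_Psi : (c.Psi u)ᵀ = c.Psi u := by
  ext a b
  simp [Psi, Matrix.sum_apply, H, c.symm a b]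

lemma transpose_Sigma : (c.Sigma Z u)ᵀ = c.Sigma Z u := by
  simp [Sigma, Matrix.transpose_add, Matrix.transpose_mul, transpose_Psi, Matrix.mul_assoc]

lemma posDef_Sigma (hψ : ψ ∈ c.paramSet) : (c.Sigma Z ψ).PosDef := by
  refine Matrix.PosDef.posSemidef_add ?_ ?_
  · exact hψ.1.mul_mul_conjTranspose_same Z
  · exact Matrix.PosDef.one.smul hψ.2

lemma isHermitian_A (ψ : EuclideanSpace ℝ (Fin (k + 1))) : (c.A Z u ψ).IsHermitian := by
  rw [Matrix.IsHermitian, Matrix.conjTranspose_eq_transpose_of_trivial, A,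
    Matrix.transpose_mul, Matrix.transpose_mul, transpose_invSqrt, transpose_Sigma,
    Matrix.mul_assoc]

/-- A matrix `V` with `Σ(ψ) = V Vᵀ` and `Σ(u) = V D Vᵀ`, for the diagonal matrix `D` of eigenvalues
of `A(u, ψ)`. -/
noncomputable def diagonalizer (ψ : EuclideanSpace ℝ (Fin (k + 1))) : Matrix (Fin n) (Fin n) ℝ :=
  CFC.sqrt (c.Sigma Z ψ) * ((c.isHermitian_A Z u ψ).eigenvectorUnitary : Matrix _ _ ℝ)

lemma isUnit_det_diagonalizer (hψ : ψ ∈ c.paramSet) : IsUnit (c.diagonalizer Z u ψ).det := by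
  rw [diagonalizer, det_mul]
  refine (isUnit_det_sqrt (c.posDef_Sigma Z hψ).posSemidef (c.posDef_Sigma Z hψ).isUnit).mul ?_
  have := congrArg det (eigenvectorUnitary_mul_transpose (c.isHermitian_A Z u ψ))
  rw [det_mul, det_one] at this
  exact IsUnit.of_mul_eq_one _ this

lemma diagonalizer_mul_transpose (hψ : ψ ∈ c.paramSet) :
    c.diagonalizer Z u ψ * (c.diagonalizer Z u ψ)ᵀ = c.Sigma Z ψ := by
  rw [diagonalizer, transpose_mul, transpose_sqrt, Matrix.mul_assoc,
    ← Matrix.mul_assoc _ _ (CFC.sqrt (c.Sigma Z ψ)), eigenvectorUnitary_mul_transpose,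
    Matrix.one_mul, CFC.sqrt_mul_sqrt_self _ (c.posDef_Sigma Z hψ).posSemidef.nonneg]

lemma diagonalizer_mul_diagonal_mul_transpose (hψ : ψ ∈ c.paramSet) :
    c.diagonalizer Z u ψ * diagonal (c.isHermitian_A Z u ψ).eigenvalues
      * (c.diagonalizer Z u ψ)ᵀ = c.Sigma Z u := by
  have hu := isUnit_det_sqrt (c.posDef_Sigma Z hψ).posSemidef (c.posDef_Sigma Z hψ).isUnit
  have h := eq_eigenvectorUnitary_mul_diagonal_mul (c.isHermitian_A Z u ψ)
  rw [diagonalizer, transpose_mul, transpose_sqrt]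
  calc _ = CFC.sqrt (c.Sigma Z ψ) * c.A Z u ψ * CFC.sqrt (c.Sigma Z ψ) := by
        conv_rhs => rw [h]
        simp only [Matrix.mul_assoc]
    _ = (CFC.sqrt (c.Sigma Z ψ) * (CFC.sqrt (c.Sigma Z ψ))⁻¹) * c.Sigma Z u
        * ((CFC.sqrt (c.Sigma Z ψ))⁻¹ * CFC.sqrt (c.Sigma Z ψ)) := by
        simp only [A, invSqrt, Matrix.mul_assoc]
    _ = _ := by rw [mul_nonsing_inv _ hu, nonsing_inv_mul _ hu, Matrix.one_mul, Matrix.mul_one]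

/-- `gradient` defaults to zero where differentiability fails, so this makes the score meaningful.
It holds on a full neighbourhood argument: `ψ` may be a boundary point of `paramSet`, but `det Σ(ψ)
≠ 0` suffices. -/
lemma differentiableAt_logLik (hψ : ψ ∈ c.paramSet) (y : EuclideanSpace ℝ (Fin n)) :
    DifferentiableAt ℝ (c.logLik Z y) ψ := by
  have hM : ∀ i j, DifferentiableAt ℝ (fun v ↦ c.Sigma Z v i j) ψ := by
    intro i j
    simp only [Sigma, Psi, Matrix.add_apply, Matrix.smul_apply, Matrix.mul_apply,
      Matrix.sum_apply, smul_eq_mul]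
    fun_prop
  have hdet : (c.Sigma Z ψ).det ≠ 0 := (c.posDef_Sigma Z hψ).det_pos.ne'
  exact (((DifferentiableAt.matrix_det hM).log hdet).add
    (DifferentiableAt.dotProduct_inv_mulVec hM hdet y.ofLp)).const_mul _

/-- Every linear combination of the score is a centred diagonal quadratic form. -/
lemma inner_score (hψ : ψ ∈ c.paramSet) (y : EuclideanSpace ℝ (Fin n)) :
    inner ℝ u (c.score Z y ψ) = ∑ j, (c.isHermitian_A Z u ψ).eigenvalues j / 2
      * (((c.diagonalizer Z u ψ)⁻¹ *ᵥ y.ofLp) j ^ 2 - 1) := by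
  rw [score, real_inner_comm, inner_gradient_left]
  have hline : HasDerivAt (fun s : ℝ ↦ ψ + s • u) u 0 := by
    simpa using ((hasDerivAt_id (0 : ℝ)).smul_const u).const_add ψ
  have h1 : HasDerivAt (fun s : ℝ ↦ c.logLik Z y (ψ + s • u)) (fderiv ℝ (c.logLik Z y) ψ u) 0 := by
    have hf : HasFDerivAt (c.logLik Z y) (fderiv ℝ (c.logLik Z y) ψ) (ψ + (0 : ℝ) • u) := by
      simpa using (c.differentiableAt_logLik Z hψ y).hasFDerivAt
    exact hf.comp_hasDerivAt 0 hline
  -- The directional derivative is computed twice, through the gradient and through the diagonalised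
  -- line; uniqueness equates the results.
  refine h1.unique ?_
  have h2 := hasDerivAt_logLik_diagonalized (c.diagonalizer Z u ψ)
    (c.isHermitian_A Z u ψ).eigenvalues (c.isUnit_det_diagonalizer Z u hψ) y.ofLp
  simp only [c.diagonalizer_mul_transpose Z u hψ,
    c.diagonalizer_mul_diagonal_mul_transpose Z u hψ, ← Sigma_add_smul] at h2
  exact h2

/-- The standard Gaussian has independent coordinates in every orthonormal basis; taking the
eigenbasis of `A(u, ψ)` aligns them with the quadratic form of the score. -/
lemma modelLaw_eq_map_pi (ψ : EuclideanSpace ℝ (Fin (k + 1))) :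
    c.modelLaw Z ψ = (Measure.pi fun _ : Fin n ↦ gaussianReal 0 1).map
      fun x ↦ WithLp.toLp 2 (c.diagonalizer Z u ψ *ᵥ x) := by
  rw [modelLaw, multivariateGaussian,
    stdGaussian_eq_map_pi_orthonormalBasis (c.isHermitian_A Z u ψ).eigenvectorBasis,
    Measure.map_map (by fun_prop) (by fun_prop)]
  congr 1
  ext x i
  simp only [Function.comp_apply, zero_add, Matrix.ofLp_toEuclideanCLM, diagonalizer,
    ← mulVec_mulVec]
  congr 2
  ext j
  simp [mulVec, dotProduct, IsHermitian.eigenvectorUnitary_apply, mul_comm]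

lemma measurable_inner_score (hψ : ψ ∈ c.paramSet) :
    Measurable fun y ↦ inner ℝ u (c.score Z y ψ) := by
  simp only [c.inner_score Z u hψ, mulVec, dotProduct]
  fun_prop

lemma inner_score_diagonalizer_mulVec (hψ : ψ ∈ c.paramSet) (x : Fin n → ℝ) :
    inner ℝ u (c.score Z (WithLp.toLp 2 (c.diagonalizer Z u ψ *ᵥ x)) ψ)
      = ∑ j, (c.isHermitian_A Z u ψ).eigenvalues j / 2 * (x j ^ 2 - 1) := by
  rw [c.inner_score Z u hψ, mulVec_mulVec,
    nonsing_inv_mul _ (c.isUnit_det_diagonalizer Z u hψ), one_mulVec]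

lemma measurable_toLp_mulVec (V : Matrix (Fin n) (Fin n) ℝ) :
    Measurable fun x : Fin n → ℝ ↦ (WithLp.toLp 2 (V *ᵥ x) : EuclideanSpace ℝ (Fin n)) := by
  fun_prop

lemma map_inner_score_modelLaw (hψ : ψ ∈ c.paramSet) :
    (c.modelLaw Z ψ).map (fun y ↦ inner ℝ u (c.score Z y ψ))
      = (Measure.pi fun _ : Fin n ↦ gaussianReal 0 1).map
        fun x ↦ ∑ j, (c.isHermitian_A Z u ψ).eigenvalues j / 2 * (x j ^ 2 - 1) := by
  rw [c.modelLaw_eq_map_pi Z u ψ,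
    Measure.map_map (c.measurable_inner_score Z u hψ) (measurable_toLp_mulVec _)]
  congr 1
  ext x
  exact c.inner_score_diagonalizer_mulVec Z u hψ x

lemma memLp_inner_score (hψ : ψ ∈ c.paramSet) :
    MemLp (fun y ↦ inner ℝ u (c.score Z y ψ)) 2 (c.modelLaw Z ψ) := by
  rw [c.modelLaw_eq_map_pi Z u ψ, memLp_map_measure_iff
    (c.measurable_inner_score Z u hψ).aestronglyMeasurable
    (measurable_toLp_mulVec _).aemeasurable]
  refine (memLp_quadForm_pi (c.isHermitian_A Z u ψ).eigenvalues).ae_eq (ae_of_all _ fun x ↦ ?_)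
  exact (c.inner_score_diagonalizer_mulVec Z u hψ x).symm

lemma variance_inner_score (hψ : ψ ∈ c.paramSet) :
    Var[fun y ↦ inner ℝ u (c.score Z y ψ); c.modelLaw Z ψ] = frobNorm (c.A Z u ψ) ^ 2 / 2 := by
  rw [frobNorm_sq_eq_sum_eigenvalues_sq (c.isHermitian_A Z u ψ), ← variance_quadForm_pi,
    c.modelLaw_eq_map_pi Z u ψ, variance_map
    (c.measurable_inner_score Z u hψ).aemeasurable (measurable_toLp_mulVec _).aemeasurable]
  congr 1
  ext x
  exact c.inner_score_diagonalizer_mulVec Z u hψ x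

instance (ψ : EuclideanSpace ℝ (Fin (k + 1))) : IsProbabilityMeasure (c.modelLaw Z ψ) := by
  unfold modelLaw
  infer_instance

lemma memLp_score_apply (hψ : ψ ∈ c.paramSet) (i : Fin (k + 1)) :
    MemLp (fun y ↦ c.score Z y ψ i) 2 (c.modelLaw Z ψ) := by
  simpa [EuclideanSpace.inner_single_left] using
    c.memLp_inner_score Z (EuclideanSpace.single i 1) hψ

/-- Bilinearity of covariance turns the left side into the variance of `uᵀS`. This ties the Fisher
information to the Frobenius norm. -/
lemma dotProduct_fisherInfo_mulVec (hψ : ψ ∈ c.paramSet) :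
    u.ofLp ⬝ᵥ c.fisherInfo Z ψ *ᵥ u.ofLp = frobNorm (c.A Z u ψ) ^ 2 / 2 := by
  rw [← c.variance_inner_score Z u hψ,
    ← covariance_self (c.measurable_inner_score Z u hψ).aemeasurable]
  have e : (fun y ↦ inner ℝ u (c.score Z y ψ)) = fun y ↦ ∑ i, u i * c.score Z y ψ i := by
    ext y
    simp [PiLp.inner_apply, mul_comm]
  have hm : ∀ i, MemLp (fun y ↦ u i * c.score Z y ψ i) 2 (c.modelLaw Z ψ) := fun i ↦
    (c.memLp_score_apply Z hψ i).const_mul _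
  rw [e, covariance_fun_sum_fun_sum hm hm]
  simp only [dotProduct, mulVec, Finset.mul_sum, fisherInfo, Matrix.of_apply]
  refine Finset.sum_congr rfl fun i _ ↦ Finset.sum_congr rfl fun j _ ↦ ?_
  rw [covariance_const_mul_left, covariance_const_mul_right]
  ring

lemma posSemidef_fisherInfo (hψ : ψ ∈ c.paramSet) : (c.fisherInfo Z ψ).PosSemidef := by
  refine Matrix.PosSemidef.of_dotProduct_mulVec_nonneg ?_ fun x ↦ ?_
  · ext i j
    simp [fisherInfo, covariance_comm]
  · have := c.dotProduct_fisherInfo_mulVec Z (WithLp.toLp 2 x) hψ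
    simp only [star_trivial]
    rw [this]
    positivity

lemma inner_scoreStat (v : EuclideanSpace ℝ (Fin (k + 1))) (ψ : EuclideanSpace ℝ (Fin (k + 1)))
    (y : EuclideanSpace ℝ (Fin n)) :
    inner ℝ v (c.scoreStat Z y ψ) = inner ℝ (c.vTilde Z v ψ) (c.score Z y ψ) := by
  rw [scoreStat, Matrix.inner_toEuclideanCLM, real_inner_comm, vTilde, Matrix.inner_toEuclideanCLM,
    dotProduct_mulVec, ← mulVec_transpose, transpose_invSqrt, dotProduct_comm]

/-- Standardisation: `ṽᵀ I(ψ) ṽ = ‖v‖² = 1` is half the squared Frobenius norm. -/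
lemma frobNorm_A_vTilde_sq (hψ : ψ ∈ c.paramSet) (hI : IsUnit (c.fisherInfo Z ψ))
    {v : EuclideanSpace ℝ (Fin (k + 1))} (hv : ‖v‖ = 1) :
    frobNorm (c.A Z (c.vTilde Z v ψ) ψ) ^ 2 = 2 := by
  have h := c.dotProduct_fisherInfo_mulVec Z (c.vTilde Z v ψ) hψ
  have h1 : (c.vTilde Z v ψ).ofLp ⬝ᵥ c.fisherInfo Z ψ *ᵥ (c.vTilde Z v ψ).ofLp = 1 := by
    rw [vTilde, Matrix.ofLp_toEuclideanCLM]
    have hT : invSqrt (c.fisherInfo Z ψ) *ᵥ v.ofLp = v.ofLp ᵥ* invSqrt (c.fisherInfo Z ψ) := by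
      rw [← mulVec_transpose, transpose_invSqrt]
    nth_rw 1 [hT]
    rw [← dotProduct_mulVec, mulVec_mulVec, mulVec_mulVec,
      invSqrt_mul_mul_invSqrt (c.posSemidef_fisherInfo Z hψ) hI, one_mulVec]
    have : ‖v‖ ^ 2 = 1 := by rw [hv, one_pow]
    rw [← this, EuclideanSpace.real_norm_sq_eq]
    simp [dotProduct, sq]
  linarith

end Score

end CovPattern

/-! ### Conclusion -/

theorem lemma4 {n q k : ℕ} (c : CovPattern q k) (Z : Matrix (Fin n) (Fin q) ℝ)
    (ψ : EuclideanSpace ℝ (Fin (k + 1))) (hψ : ψ ∈ c.paramSet)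
    (hI : IsUnit (c.fisherInfo Z ψ))
    (v : EuclideanSpace ℝ (Fin (k + 1))) (hv : ‖v‖ = 1)
    (hv' : c.vTilde Z v ψ ≠ 0)
    (ha : c.a Z (c.vTilde Z v ψ) ψ ^ 2 < 1 / 8)
    {Ω : Type*} [MeasurableSpace Ω] (P : Measure Ω) [IsProbabilityMeasure P]
    (Y : Ω → EuclideanSpace ℝ (Fin n)) (hY : HasLaw Y (c.modelLaw Z ψ) P) :
    ∃ g : ℝ → ℝ,
      IsContinuousDensity g (P.map fun ω => inner ℝ v (c.scoreStat Z (Y ω) ψ)) ∧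
      ∀ t : ℝ, |g t - gaussianPDFReal 0 1 t| ≤
        0.14 * (4 + 0.29 / (1 - 8 * c.a Z (c.vTilde Z v ψ) ψ ^ 2) ^ 2)
          * c.a Z (c.vTilde Z v ψ) ψ := by
  set u := c.vTilde Z v ψ with hu
  have hA := c.isHermitian_A Z u ψ
  have hfrob : frobNorm (c.A Z u ψ) ^ 2 = 2 := c.frobNorm_A_vTilde_sq Z hψ hI hv
  have hfrob0 : frobNorm (c.A Z u ψ) ≠ 0 := by
    intro h
    rw [h] at hfrob
    norm_num at hfrob
  have hsum : ∑ j, hA.eigenvalues j ^ 2 = 2 := by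
    rw [← frobNorm_sq_eq_sum_eigenvalues_sq hA, hfrob]
  have haeq : c.a Z u ψ = specNorm (c.A Z u ψ) / frobNorm (c.A Z u ψ) := by
    rw [CovPattern.a, if_neg hfrob0]
  have hle : ∀ j, hA.eigenvalues j ^ 2 ≤ 2 * c.a Z u ψ ^ 2 := by
    intro j
    rw [haeq, div_pow, hfrob, mul_div_cancel₀ _ two_ne_zero, ← sq_abs]
    exact pow_le_pow_left₀ (abs_nonneg _) (abs_eigenvalues_le_specNorm hA j) 2
  have hnn : 0 ≤ c.a Z u ψ := by
    rw [haeq]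
    exact div_nonneg (norm_nonneg _) (Real.sqrt_nonneg _)
  -- If `a` vanished, every eigenvalue would, against `∑ λ_j² = 2`.
  have hpos : 0 < c.a Z u ψ := by
    refine lt_of_le_of_ne hnn fun h0 ↦ ?_
    have : ∑ j, hA.eigenvalues j ^ 2 ≤ 0 := Finset.sum_nonpos fun j _ ↦ by
      simpa [← h0] using hle j
    linarith
  have hlaw : P.map (fun ω ↦ inner ℝ v (c.scoreStat Z (Y ω) ψ))
      = (Measure.pi fun _ : Fin n ↦ gaussianReal 0 1).map
        fun x ↦ ∑ j, hA.eigenvalues j / 2 * (x j ^ 2 - 1) := by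
    rw [← c.map_inner_score_modelLaw Z u hψ, ← hY.map_eq,
      AEMeasurable.map_map_of_aemeasurable (c.measurable_inner_score Z u hψ).aemeasurable
        hY.aemeasurable]
    congr 1
    ext ω
    exact c.inner_scoreStat Z v ψ (Y ω)
  rw [hlaw]
  exact exists_isContinuousDensity_quadForm hpos ha hsum hle
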